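/- Let $M$ be a smooth (Hausdorff, finite-dimensional, not necessarily orientable) manifold of dimension $n$, and let $N$ be a Nijenhuis tensor on $M$, that is, a smooth $(1,1)$-tensor with $[NX,NY]=N\bigl([NX,Y]+[X,NY]-N[X,Y]\bigr)$ for all vector fields $X,Y$. Consider the Lie algebroid $(TM,N,[\cdot,\cdot]_N)$ with underlying bundle $TM$, anchor $N$ and bracket $[X,Y]_N=[NX,Y]+[X,NY]-N[X,Y]$, and let $d_N$ be its differential, so that $\langle d_Nf,X\rangle=df(NX)$ for functions $f$ and $(d_N\xi)(X,Y)=(NX)\langle\xi,Y\rangle-(NY)\langle\xi,X\rangle-\langle\xi,[X,Y]_N\rangle$ for $1$-forms $\xi$. Given a nowhere vanishing smooth section $s$ of the line bundle $\Lambda^nTM\otimes\Lambda^nT^*M$, the modular $1$-form $\xi_s$ is the $1$-form such that, for all vector fields $X$ and wherever locally $s=\lambda\otimes\mu$ with $\lambda=e_1\wedge\dots\wedge e_n$ a product of vector fields and $\mu$ an $n$-form, $$\langle\xi_s,X\rangle\,\lambda\otimes\mu=[X,\lambda]_N\otimes\mu+\lambda\otimes L_{NX}\mu,\qquad [X,\lambda]_N=\sum_{j=1}^n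 e_1\wedge\dots\wedge[X,e_j]_N\wedge\dots\wedge e_n .$$ The modular class of the Lie algebroid is the class of $\xi_s$ in the first $d_N$-cohomology. Then the modular class of $(TM,N,[\cdot,\cdot]_N)$ is well defined and is the $d_N$-cohomology class of the $1$-form $d\,\mathrm{Tr}\,N$. That is: $d\,\mathrm{Tr}\,N$ is $d_N$-closed; nowhere vanishing sections $s$ exist; for each of them there is exactly one modular $1$-form $\xi_s$, it is $d_N$-closed, and $\xi_s-d\,\mathrm{Tr}\,N=d_Nf$ for some smooth function $f$ on $M$. -/

import Mathlib

open Bundle Manifold ContDiff Topology TensorProduct VectorField Module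

set_option linter.unusedSectionVars false

noncomputable section
namespace NijenhuisModular

section Basic
variable (E : Type*) [NormedAddCommGroup E] [NormedSpace ℝ E]
  (M : Type*) [TopologicalSpace M] [ChartedSpace E M] [IsManifold 𝓘(ℝ, E) ∞ M]

/-- Smooth vector fields on `M`. -/
abbrev VF := ContMDiffSection 𝓘(ℝ, E) E ∞ (TangentSpace 𝓘(ℝ, E) : M → Type _)

/-- Smooth real functions on `M`. -/
abbrev Fun := C^∞⟮𝓘(ℝ, E), M; 𝓘(ℝ, ℝ), ℝ⟯

/-- Smooth `(1,1)`-tensors on `M`, as smooth fields of endomorphisms of the tangent spaces. -/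
abbrev EndoField := ContMDiffSection 𝓘(ℝ, E) (E →L[ℝ] E) ∞
  (fun x : M => TangentSpace 𝓘(ℝ, E) x →L[ℝ] TangentSpace 𝓘(ℝ, E) x)

/-- Smooth differential `k`-forms on `M`. -/
abbrev Form (k : ℕ) := ContMDiffSection 𝓘(ℝ, E) (E [⋀^Fin k]→L[ℝ] ℝ) ∞
  (fun x : M => TangentSpace 𝓘(ℝ, E) x [⋀^Fin k]→L[ℝ] Bundle.Trivial M ℝ x)

end Basic

/-! ### Vector fields, forms and the Lie derivative -/

section Lie
variable {E : Type*} [NormedAddCommGroup E] [NormedSpace ℝ E]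
  {M : Type*} [TopologicalSpace M] [ChartedSpace E M] [IsManifold 𝓘(ℝ, E) ∞ M]

/-- The Lie bracket of smooth vector fields. -/
def vfBracket [FiniteDimensional ℝ E] (X Y : VF E M) : VF E M :=
  ⟨mlieBracket 𝓘(ℝ, E) X Y, by
    have : CompleteSpace E := FiniteDimensional.complete ℝ E
    have : IsManifold 𝓘(ℝ, E) (minSmoothness ℝ 2) M := by
      rw [minSmoothness_of_isRCLikeNormedField]; infer_instance
    have : IsManifold 𝓘(ℝ, E) (((⊤ : ℕ∞) : WithTop ℕ∞) + 1) M := by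
      simpa using (inferInstance : IsManifold 𝓘(ℝ, E) ∞ M)
    exact ContDiff.mlieBracket_vectorField (I := 𝓘(ℝ, E)) (m := ⊤) (n := ⊤)
      X.contMDiff Y.contMDiff (by simp)⟩

/-- The value at `x` of a `k`-form, as an alternating form on the tangent space at `x`. -/
def formAt {k : ℕ} (μ : Form E M k) (x : M) : TangentSpace 𝓘(ℝ, E) x [⋀^Fin k]→ₗ[ℝ] ℝ :=
  (μ x).toAlternatingMap

/-- The vector field that extends the tangent vector `v` at `x` and has constant coefficients
in the chart around `x` (it is zero outside the domain of that chart). -/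
def coordField {x : M} (v : TangentSpace 𝓘(ℝ, E) x) (y : M) : TangentSpace 𝓘(ℝ, E) y :=
  (trivializationAt E (TangentSpace 𝓘(ℝ, E)) x).symmL ℝ y
    ((trivializationAt E (TangentSpace 𝓘(ℝ, E)) x).continuousLinearMapAt ℝ x v)

lemma coordField_self {x : M} (v : TangentSpace 𝓘(ℝ, E) x) : coordField v x = v :=
  (trivializationAt E (TangentSpace 𝓘(ℝ, E)) x).symmL_continuousLinearMapAt
    (FiberBundle.mem_baseSet_trivializationAt' x) v

lemma coordField_add {x : M} (v w : TangentSpace 𝓘(ℝ, E) x) :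
    coordField (v + w) = coordField v + coordField w := by
  funext y
  simp only [coordField, map_add, Pi.add_apply]

lemma coordField_smul {x : M} (c : ℝ) (v : TangentSpace 𝓘(ℝ, E) x) :
    coordField (c • v) = c • coordField v := by
  funext y
  simp only [coordField, map_smul, Pi.smul_apply]

lemma contMDiffAt_coordField {x : M} (v : TangentSpace 𝓘(ℝ, E) x) :
    ContMDiffAt 𝓘(ℝ, E) (𝓘(ℝ, E).prod 𝓘(ℝ, E)) ∞
      (fun y => (⟨y, coordField v y⟩ : TangentBundle 𝓘(ℝ, E) M)) x := by
  refine (FiberBundle.contMDiffAt_extend 𝓘(ℝ, E) E v (k := ∞)).congr_of_eventuallyEq ?_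
  filter_upwards [(trivializationAt E (TangentSpace 𝓘(ℝ, E)) x).open_baseSet.mem_nhds
    (FiberBundle.mem_baseSet_trivializationAt' x)] with y hy
  have hx : x ∈ (trivializationAt E (TangentSpace 𝓘(ℝ, E)) x).baseSet :=
    FiberBundle.mem_baseSet_trivializationAt' x
  simp only [coordField, FiberBundle.extend]
  rw [Trivialization.symmL_apply _ hy, Trivialization.continuousLinearMapAt_apply,
    Trivialization.coe_linearMapAt_of_mem _ hx]

lemma mdifferentiableAt_formAt_coordField {k : ℕ} (μ : Form E M k) {x : M}
    (v : Fin k → TangentSpace 𝓘(ℝ, E) x) :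
    MDifferentiableAt 𝓘(ℝ, E) 𝓘(ℝ, ℝ)
      (fun y => formAt μ y (fun i => coordField (v i) y)) x := by
  have h := (contMDiffAt_section _ |>.1 (μ.contMDiff x))
  let w : Fin k → E := fun i =>
    (trivializationAt E (TangentSpace 𝓘(ℝ, E)) x).continuousLinearMapAt ℝ x (v i)
  have h2 := (ContinuousAlternatingMap.apply ℝ E ℝ w).contMDiff.contMDiffAt.comp x h (n := ∞)
  refine (h2.mdifferentiableAt (by simp)).congr_of_eventuallyEq (.of_forall fun y => ?_)
  change formAt μ y (fun i => coordField (v i) y) =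
    (ContinuousAlternatingMap.inCoordinates (E₁ := (TangentSpace 𝓘(ℝ, E) : M → Type _))
      (E₂ := Bundle.Trivial M ℝ) E ℝ x y x y (μ y)) w
  simp [formAt, coordField, ContinuousAlternatingMap.inCoordinates, w, Function.comp_def]

/-- The value at `x` of `(L_Y μ)(Z₁, …, Zₖ) = Y (μ (Z₁, …, Zₖ)) - ∑ᵢ μ (Z₁, …, [Y, Zᵢ], …, Zₖ)`,
for vector fields `Zᵢ` that are smooth near `x`. -/
def lieDerivEval {k : ℕ} (Y : VF E M) (μ : Form E M k) (x : M)
    (Z : Fin k → Π y : M, TangentSpace 𝓘(ℝ, E) y) : ℝ :=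
  mvfderiv 𝓘(ℝ, E) (fun y => formAt μ y (fun i => Z i y)) x (Y x)
    - ∑ i, formAt μ x (Function.update (fun j => Z j x) i (mlieBracket 𝓘(ℝ, E) Y (Z i) x))

/-- The value at `x` of the Lie derivative `L_Y μ` of a `k`-form: tangent vectors at `x` are
extended to vector fields with constant coefficients in the chart around `x`, and the usual
formula for `(L_Y μ)(Z₁, …, Zₖ)` (which is tensorial in the `Zᵢ`) is applied to them. -/
def lieDeriv [FiniteDimensional ℝ E] {k : ℕ} (Y : VF E M) (μ : Form E M k) (x : M) :
    TangentSpace 𝓘(ℝ, E) x [⋀^Fin k]→ₗ[ℝ] ℝ where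
  toFun v := lieDerivEval Y μ x (fun i => coordField (v i))
  map_update_add' := by
    have : CompleteSpace E := FiniteDimensional.complete ℝ E
    intro inst v i a b
    obtain rfl : inst = instDecidableEqFin k := Subsingleton.elim _ _
    have key : ∀ (c : TangentSpace 𝓘(ℝ, E) x) (y : M),
        (fun j => coordField (Function.update v i c j) y) =
          Function.update (fun j => coordField (v j) y) i (coordField c y) := by
      intro c y
      funext j
      by_cases h : j = i
      · subst h; simp
      · simp [h]
    have e1 := mdifferentiableAt_formAt_coordField μ (Function.update v i a)
    have e2 := mdifferentiableAt_formAt_coordField μ (Function.update v i b)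
    have hd : (fun y => formAt μ y (fun j => coordField (Function.update v i (a + b) j) y)) =
        (fun y => formAt μ y (fun j => coordField (Function.update v i a j) y)) +
        (fun y => formAt μ y (fun j => coordField (Function.update v i b j) y)) := by
      funext y
      simp only [key, Pi.add_apply, coordField_add, AlternatingMap.map_update_add]
    simp only [lieDerivEval]
    rw [hd, mvfderiv_add e1 e2]
    simp only [coordField_self, add_apply]
    have hs : ∀ l, formAt μ x (Function.update (Function.update v i (a + b)) l
          (mlieBracket 𝓘(ℝ, E) Y (coordField (Function.update v i (a + b) l)) x)) =
        formAt μ x (Function.update (Function.update v i a) l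
          (mlieBracket 𝓘(ℝ, E) Y (coordField (Function.update v i a l)) x)) +
        formAt μ x (Function.update (Function.update v i b) l
          (mlieBracket 𝓘(ℝ, E) Y (coordField (Function.update v i b l)) x)) := by
      intro l
      by_cases h : l = i
      · subst h
        simp only [Function.update_self, Function.update_idem, coordField_add]
        rw [mlieBracket_add_right ((contMDiffAt_coordField a).mdifferentiableAt (by simp))
          ((contMDiffAt_coordField b).mdifferentiableAt (by simp)),
          AlternatingMap.map_update_add]
      · simp only [Function.update_of_ne h]
        simp only [Function.update_comm (Ne.symm h), AlternatingMap.map_update_add]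
    simp only [hs, Finset.sum_add_distrib]
    ring
  map_update_smul' := by
    have : CompleteSpace E := FiniteDimensional.complete ℝ E
    intro inst v i c a
    obtain rfl : inst = instDecidableEqFin k := Subsingleton.elim _ _
    have key : ∀ (c : TangentSpace 𝓘(ℝ, E) x) (y : M),
        (fun j => coordField (Function.update v i c j) y) =
          Function.update (fun j => coordField (v j) y) i (coordField c y) := by
      intro c y
      funext j
      by_cases h : j = i
      · subst h; simp
      · simp [h]
    have e1 := mdifferentiableAt_formAt_coordField μ (Function.update v i a)
    have hd : (fun y => formAt μ y (fun j => coordField (Function.update v i (c • a) j) y)) =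
        (fun _ : M => c) •
        (fun y => formAt μ y (fun j => coordField (Function.update v i a j) y)) := by
      funext y
      simp only [key, Pi.smul_apply', coordField_smul, Pi.smul_apply,
        AlternatingMap.map_update_smul]
    simp only [lieDerivEval]
    rw [hd, mvfderiv_smul mdifferentiableAt_const e1]
    simp only [coordField_self, mvfderiv_const]
    have hs : ∀ l, formAt μ x (Function.update (Function.update v i (c • a)) l
          (mlieBracket 𝓘(ℝ, E) Y (coordField (Function.update v i (c • a) l)) x)) =
        c * formAt μ x (Function.update (Function.update v i a) l
          (mlieBracket 𝓘(ℝ, E) Y (coordField (Function.update v i a l)) x)) := by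
      intro l
      by_cases h : l = i
      · subst h
        simp only [Function.update_self, Function.update_idem, coordField_smul]
        rw [mlieBracket_const_smul_right ((contMDiffAt_coordField a).mdifferentiableAt (by simp)),
          AlternatingMap.map_update_smul, smul_eq_mul]
      · simp only [Function.update_of_ne h]
        simp only [Function.update_comm (Ne.symm h), AlternatingMap.map_update_smul, smul_eq_mul]
    simp only [hs, ← Finset.mul_sum]
    simp [mul_sub]
  map_eq_zero_of_eq' v i j hij hne := by
    have h0 : (fun y => formAt μ y (fun l => coordField (v l) y)) = 0 := by
      funext y
      exact (formAt μ y).map_eq_zero_of_eq _ (by simp [hij]) hne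
    simp only [lieDerivEval, h0, coordField_self]
    rw [Finset.sum_eq_add i j hne]
    · have : Function.update v j (mlieBracket 𝓘(ℝ, E) Y (coordField (v j)) x) =
          (Function.update v i (mlieBracket 𝓘(ℝ, E) Y (coordField (v i)) x)) ∘
            Equiv.swap i j := by
        funext l
        by_cases h1 : l = i
        · subst h1; simp [hne, hne.symm, hij]
        · by_cases h2 : l = j
          · subst h2; simp [hij]
          · simp [h1, h2, Equiv.swap_apply_of_ne_of_ne]
      rw [this, (formAt μ x).map_swap _ hne]
      simp
    · intro l _ hl
      exact (formAt μ x).map_eq_zero_of_eq _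
        (by rw [Function.update_of_ne hl.1.symm, Function.update_of_ne hl.2.symm, hij]) hne
    · simp
    · simp

end Lie

/-! ### Sections and one-forms of a vector bundle -/

section Bundles
variable {E : Type*} [NormedAddCommGroup E] [NormedSpace ℝ E]
  {M : Type*} [TopologicalSpace M] [ChartedSpace E M] [IsManifold 𝓘(ℝ, E) ∞ M]
  {F : Type*} [NormedAddCommGroup F] [NormedSpace ℝ F] {V : M → Type*}
  [TopologicalSpace (TotalSpace F V)] [∀ x, AddCommGroup (V x)] [∀ x, Module ℝ (V x)]
  [∀ x, TopologicalSpace (V x)] [FiberBundle F V] [VectorBundle ℝ F V]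
  [ContMDiffVectorBundle ∞ F V 𝓘(ℝ, E)]

variable (E F V) in
/-- Smooth sections of the vector bundle `V`. -/
abbrev Sec := ContMDiffSection 𝓘(ℝ, E) F ∞ V

variable (E F V) in
/-- Smooth sections of the dual bundle of `V`. -/
abbrev DualSec := ContMDiffSection 𝓘(ℝ, E) (F →L[ℝ] ℝ) ∞
  (fun x => V x →L[ℝ] Bundle.Trivial M ℝ x)

/-- The product of a smooth function and a smooth section. -/
def fsmul (f : Fun E M) (X : Sec E F V) : Sec E F V :=
  ⟨fun x => f x • X x, f.contMDiff.smul_section X.contMDiff⟩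

/-- The function `⟨ξ, X⟩`. -/
def pairing (ξ : DualSec E F V) (X : Sec E F V) (x : M) : ℝ := ξ x (X x)

lemma contMDiff_pairing (ξ : DualSec E F V) (X : Sec E F V) :
    ContMDiff 𝓘(ℝ, E) 𝓘(ℝ, ℝ) ∞ (pairing ξ X) := by
  have h : ContMDiff 𝓘(ℝ, E) (𝓘(ℝ, E).prod 𝓘(ℝ, ℝ)) ∞
      (fun x => TotalSpace.mk' ℝ (E := Bundle.Trivial M ℝ) x (ξ x (X x))) :=
    ContMDiff.clm_bundle_apply (b := id) ξ.contMDiff X.contMDiff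
  intro x
  exact (contMDiffAt_section _).1 (h x)

/-- The differential `df` of a smooth function, as a smooth 1-form on `M`. -/
def differential (f : Fun E M) : DualSec E E (TangentSpace 𝓘(ℝ, E) : M → Type _) :=
  ⟨fun x => mvfderiv 𝓘(ℝ, E) f x, by
    intro x₀
    rw [contMDiffAt_hom_bundle]
    refine ⟨contMDiffAt_id, ?_⟩
    have h := ContMDiffAt.mfderiv_const (f.contMDiff x₀) (m := ∞) (n := ∞) (by simp)
    refine h.congr_of_eventuallyEq (.of_forall fun y => ?_)
    ext v
    simp [inTangentCoordinates, ContinuousLinearMap.inCoordinates, mvfderiv]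
    rfl⟩

end Bundles

/-! ### Lie algebroids, their cohomology in degree one and their modular class -/

section LieAlgebroids
variable {E : Type*} [NormedAddCommGroup E] [NormedSpace ℝ E] [FiniteDimensional ℝ E]
  {M : Type*} [TopologicalSpace M] [ChartedSpace E M] [IsManifold 𝓘(ℝ, E) ∞ M]

section
variable (E) (F : Type*) [NormedAddCommGroup F] [NormedSpace ℝ F] [FiniteDimensional ℝ F]
  (V : M → Type*)
  [TopologicalSpace (TotalSpace F V)] [∀ x, AddCommGroup (V x)] [∀ x, Module ℝ (V x)]
  [∀ x, TopologicalSpace (V x)] [FiberBundle F V] [VectorBundle ℝ F V]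
  [ContMDiffVectorBundle ∞ F V 𝓘(ℝ, E)]

/-- A Lie algebroid structure on the vector bundle `V` of finite rank over `M`. -/
structure LieAlgebroid where
  /-- the anchor, a morphism of vector bundles to the tangent bundle -/
  anchor : ContMDiffSection 𝓘(ℝ, E) (F →L[ℝ] E) ∞
    (fun x : M => V x →L[ℝ] TangentSpace 𝓘(ℝ, E) x)
  /-- the bracket of sections -/
  bracket : Sec E F V → Sec E F V → Sec E F V
  add_bracket : ∀ X Y Z, bracket (X + Y) Z = bracket X Z + bracket Y Z
  bracket_add : ∀ X Y Z, bracket X (Y + Z) = bracket X Y + bracket X Z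
  bracket_self : ∀ X, bracket X X = 0
  jacobi : ∀ X Y Z, bracket X (bracket Y Z) = bracket (bracket X Y) Z + bracket Y (bracket X Z)
  leibniz : ∀ (X : Sec E F V) (f : Fun E M) (Y : Sec E F V) (x : M),
    bracket X (fsmul f Y) x = f x • bracket X Y x + mvfderiv 𝓘(ℝ, E) f x (anchor x (X x)) • Y x
  anchor_bracket : ∀ (X Y : Sec E F V) (x : M), anchor x (bracket X Y x) =
    mlieBracket 𝓘(ℝ, E) (fun y => anchor y (X y)) (fun y => anchor y (Y y)) x

end

section
variable {F : Type*} [NormedAddCommGroup F] [NormedSpace ℝ F] [FiniteDimensional ℝ F]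
  {V : M → Type*}
  [TopologicalSpace (TotalSpace F V)] [∀ x, AddCommGroup (V x)] [∀ x, Module ℝ (V x)]
  [∀ x, TopologicalSpace (V x)] [FiberBundle F V] [VectorBundle ℝ F V]
  [ContMDiffVectorBundle ∞ F V 𝓘(ℝ, E)]

/-- The section `e₁ ∧ … ∧ e_r` of `Λ^r V`, where `r` is the rank of `V`. -/
def wedge (e : Fin (finrank ℝ F) → Sec E F V) (x : M) : ⋀[ℝ]^(finrank ℝ F) (V x) :=
  exteriorPower.ιMulti ℝ (finrank ℝ F) (fun i => e i x)

/-- The fibre at `x` of the line bundle `Λ^top V ⊗ Λ^top T*M`. -/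
abbrev TopFiber (E : Type*) [NormedAddCommGroup E] [NormedSpace ℝ E]
    {M : Type*} [TopologicalSpace M] [ChartedSpace E M]
    (F : Type*) [NormedAddCommGroup F] [NormedSpace ℝ F]
    (V : M → Type*) [∀ x, AddCommGroup (V x)] [∀ x, Module ℝ (V x)] (x : M) :=
  (⋀[ℝ]^(finrank ℝ F) (V x)) ⊗[ℝ] (TangentSpace 𝓘(ℝ, E) x [⋀^Fin (finrank ℝ E)]→ₗ[ℝ] ℝ)

variable (E F V) in
/-- A nowhere vanishing smooth section of the line bundle `Λ^top V ⊗ Λ^top T*M`: near each point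
it is `λ ⊗ μ` with `λ = e₁ ∧ … ∧ e_r` for smooth sections `eᵢ` and `μ` a smooth top form on `M`.
(If `V` and `M` are orientable, such a section is given by a nowhere vanishing multisection `λ` of
top degree and a volume form `μ`.) -/
structure TopSection where
  toFun : ∀ x : M, TopFiber E F V x
  smooth : ∀ x, ∃ (e : Fin (finrank ℝ F) → Sec E F V) (μ : Form E M (finrank ℝ E)),
    ∀ᶠ y in 𝓝 x, toFun y = wedge e y ⊗ₜ[ℝ] formAt μ y
  ne_zero : ∀ x, toFun x ≠ 0

namespace LieAlgebroid
variable (A : LieAlgebroid E F V)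

/-- The vector field `ρ X` for the anchor `ρ`. -/
def anchorField (X : Sec E F V) : VF E M :=
  ⟨fun x => A.anchor x (X x), ContMDiff.clm_bundle_apply (b := id) A.anchor.contMDiff X.contMDiff⟩

/-- The Lie algebroid differential on functions, `⟨d_A f, X⟩ = df (ρ X)`. -/
def dFun : Fun E M →ₗ[ℝ] DualSec E F V where
  toFun f := ⟨fun x => (differential f x).comp (A.anchor x), by
    intro x₀
    rw [contMDiffAt_hom_bundle]
    refine ⟨contMDiffAt_id, ?_⟩
    have h1 := ((contMDiffAt_hom_bundle _).1 ((differential f).contMDiff x₀)).2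
    have h2 := ((contMDiffAt_hom_bundle _).1 (A.anchor.contMDiff x₀)).2
    refine (h1.clm_comp h2).congr_of_eventuallyEq ?_
    filter_upwards [(trivializationAt E (TangentSpace 𝓘(ℝ, E)) x₀).open_baseSet.mem_nhds
      (FiberBundle.mem_baseSet_trivializationAt' x₀)] with y hy
    ext v
    have hs := (trivializationAt E (TangentSpace 𝓘(ℝ, E)) x₀).symmL_continuousLinearMapAt
      (R := ℝ) hy
    simp only [ContinuousLinearMap.inCoordinates, ContinuousLinearMap.comp_apply, hs]⟩
  map_add' f g := by
    ext x v
    have h := mvfderiv_add (f.contMDiff.mdifferentiable (by simp) x)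
      (g.contMDiff.mdifferentiable (by simp) x)
    exact congrArg (fun T => T (A.anchor x v)) h
  map_smul' c f := by
    ext x v
    have h : mvfderiv 𝓘(ℝ, E) ((fun _ : M => c) • (f : M → ℝ)) x (A.anchor x v) =
        c * mvfderiv 𝓘(ℝ, E) f x (A.anchor x v) := by
      rw [mvfderiv_smul mdifferentiableAt_const (f.contMDiff.mdifferentiable (by simp) x),
        mvfderiv_const]
      simp
    exact h

/-- The Lie algebroid differential on 1-forms,
`(d_A ξ)(X, Y) = ρX ⟨ξ, Y⟩ - ρY ⟨ξ, X⟩ - ⟨ξ, [X, Y]⟩`. -/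
def dForm (ξ : DualSec E F V) (X Y : Sec E F V) (x : M) : ℝ :=
  mvfderiv 𝓘(ℝ, E) (pairing ξ Y) x (A.anchor x (X x))
    - mvfderiv 𝓘(ℝ, E) (pairing ξ X) x (A.anchor x (Y x))
    - pairing ξ (A.bracket X Y) x

/-- The `d_A`-closed 1-forms. -/
def cocycles : Submodule ℝ (DualSec E F V) where
  carrier := {ξ | ∀ X Y x, A.dForm ξ X Y x = 0}
  zero_mem' := by
    intro X Y x
    have h : ∀ Z, pairing (0 : DualSec E F V) Z = 0 := fun Z => rfl
    simp [dForm, h]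
  add_mem' := by
    intro ξ η hξ hη X Y x
    have h : ∀ Z, pairing (ξ + η) Z = pairing ξ Z + pairing η Z := fun Z => rfl
    have d : ∀ (θ : DualSec E F V) Z, MDifferentiableAt 𝓘(ℝ, E) 𝓘(ℝ, ℝ) (pairing θ Z) x :=
      fun θ Z => (contMDiff_pairing θ Z).mdifferentiable (by simp) x
    have h1 := hξ X Y x
    have h2 := hη X Y x
    simp only [dForm, h, mvfderiv_add (d _ _) (d _ _), add_apply, Pi.add_apply] at *
    linarith
  smul_mem' := by
    intro c ξ hξ X Y x
    have h : ∀ Z, pairing (c • ξ) Z = (fun _ : M => c) • pairing ξ Z := fun Z => rfl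
    have d : ∀ Z, MDifferentiableAt 𝓘(ℝ, E) 𝓘(ℝ, ℝ) (pairing ξ Z) x :=
      fun Z => (contMDiff_pairing ξ Z).mdifferentiable (by simp) x
    have h1 := hξ X Y x
    simp only [dForm, h, mvfderiv_smul mdifferentiableAt_const (d _), mvfderiv_const] at *
    simp only [Pi.smul_apply', smul_eq_mul, add_apply, smul_apply,
      ContinuousLinearMap.smulRight_apply, zero_apply, zero_mul, add_zero]
    rw [← mul_sub, ← mul_sub, h1, mul_zero]

/-- The `d_A`-exact 1-forms `d_A f`. -/
def coboundaries : Submodule ℝ (DualSec E F V) := LinearMap.range A.dFun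

/-- The first cohomology space of the Lie algebroid: closed 1-forms modulo exact 1-forms. -/
abbrev H1 := A.cocycles ⧸ A.coboundaries.submoduleOf A.cocycles

/-- The cohomology class of a closed 1-form. -/
def cohomologyClass (ξ : DualSec E F V) (h : ξ ∈ A.cocycles) : A.H1 :=
  Submodule.Quotient.mk ⟨ξ, h⟩

/-- The bracket `[X, e₁ ∧ … ∧ e_r] = ∑ⱼ e₁ ∧ … ∧ [X, eⱼ] ∧ … ∧ e_r`. -/
def bracketWedge (X : Sec E F V) (e : Fin (finrank ℝ F) → Sec E F V) (x : M) :
    ⋀[ℝ]^(finrank ℝ F) (V x) :=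
  ∑ j, exteriorPower.ιMulti ℝ (finrank ℝ F)
    (Function.update (fun i => e i x) j (A.bracket X (e j) x))

/-- `ξ` is the modular 1-form of the Lie algebroid with respect to the nowhere vanishing section
`s`: for all sections `X`, wherever `s = λ ⊗ μ`,
`⟨ξ, X⟩ s = [X, λ] ⊗ μ + λ ⊗ L_{ρX} μ`. -/
def IsModularForm (s : TopSection E F V) (ξ : DualSec E F V) : Prop :=
  ∀ (X : Sec E F V) (x : M) (e : Fin (finrank ℝ F) → Sec E F V) (μ : Form E M (finrank ℝ E)),
    (∀ᶠ y in 𝓝 x, s.toFun y = wedge e y ⊗ₜ[ℝ] formAt μ y) →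
    pairing ξ X x • s.toFun x =
      A.bracketWedge X e x ⊗ₜ[ℝ] formAt μ x + wedge e x ⊗ₜ[ℝ] lieDeriv (A.anchorField X) μ x

/-- `c` is the modular class of the Lie algebroid (whose line bundle `Λ^top V ⊗ Λ^top T*M` is
supposed to be trivial): the line bundle has nowhere vanishing sections, and each such section has
exactly one modular 1-form, which is closed and has the class `c`. -/
def IsModularClass (c : A.H1) : Prop :=
  Nonempty (TopSection E F V) ∧
  ∀ s : TopSection E F V, ∃ (ξ : DualSec E F V) (h : ξ ∈ A.cocycles),
    (∀ η, A.IsModularForm s η ↔ η = ξ) ∧ A.cohomologyClass ξ h = c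

end LieAlgebroid
end
end LieAlgebroids

/-! ### The Lie algebroid of a Nijenhuis tensor -/

section Nijenhuis
variable {E : Type*} [NormedAddCommGroup E] [NormedSpace ℝ E] [FiniteDimensional ℝ E]
  {M : Type*} [TopologicalSpace M] [ChartedSpace E M] [IsManifold 𝓘(ℝ, E) ∞ M]

/-- The smooth function `Tr N`. -/
def traceFun (N : EndoField E M) : Fun E M :=
  ⟨fun x => LinearMap.trace ℝ (TangentSpace 𝓘(ℝ, E) x) (N x), by
    intro x₀
    have h := ((contMDiffAt_hom_bundle _).1 (N.contMDiff x₀)).2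
    let T : (E →L[ℝ] E) →L[ℝ] ℝ :=
      LinearMap.toContinuousLinearMap ((LinearMap.trace ℝ E).comp (ContinuousLinearMap.coeLM ℝ))
    have h2 := T.contMDiff.contMDiffAt.comp x₀ h (n := ∞)
    refine h2.congr_of_eventuallyEq ?_
    filter_upwards [(trivializationAt E (TangentSpace 𝓘(ℝ, E)) x₀).open_baseSet.mem_nhds
      (FiberBundle.mem_baseSet_trivializationAt' x₀)] with y hy
    simp only [Function.comp]
    rw [ContinuousLinearMap.inCoordinates_eq hy hy]
    exact (LinearMap.trace_conj' (N y : TangentSpace 𝓘(ℝ, E) y →ₗ[ℝ] TangentSpace 𝓘(ℝ, E) y)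
      ((trivializationAt E (TangentSpace 𝓘(ℝ, E)) x₀).continuousLinearEquivAt
        ℝ y hy).toLinearEquiv).symm⟩

/-- The vector field `N X`. -/
def applyEndo (N : EndoField E M) (X : VF E M) : VF E M :=
  ⟨fun x => N x (X x), ContMDiff.clm_bundle_apply (b := id) N.contMDiff X.contMDiff⟩

/-- The deformed bracket `[X, Y]_N = [N X, Y] + [X, N Y] - N [X, Y]`. -/
def deformedBracket (N : EndoField E M) (X Y : VF E M) : VF E M :=
  vfBracket (applyEndo N X) Y + vfBracket X (applyEndo N Y) - applyEndo N (vfBracket X Y)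

/-- `N` is a Nijenhuis tensor: its Nijenhuis torsion
`[N X, N Y] - N ([N X, Y] + [X, N Y] - N [X, Y])` vanishes. -/
def IsNijenhuis (N : EndoField E M) : Prop :=
  ∀ X Y : VF E M,
    vfBracket (applyEndo N X) (applyEndo N Y) - applyEndo N (deformedBracket N X Y) = 0

lemma applyEndo_add (N : EndoField E M) (X Y : VF E M) :
    applyEndo N (X + Y) = applyEndo N X + applyEndo N Y := by
  ext x
  exact map_add (N x) (X x) (Y x)

lemma applyEndo_sub (N : EndoField E M) (X Y : VF E M) :
    applyEndo N (X - Y) = applyEndo N X - applyEndo N Y := by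
  ext x
  exact map_sub (N x) (X x) (Y x)

lemma vfBracket_add (X Y Z : VF E M) :
    vfBracket X (Y + Z) = vfBracket X Y + vfBracket X Z := by
  have : CompleteSpace E := FiniteDimensional.complete ℝ E
  ext x
  exact mlieBracket_add_right (Y.contMDiff.mdifferentiable (by simp) x)
    (Z.contMDiff.mdifferentiable (by simp) x)

lemma add_vfBracket (X Y Z : VF E M) :
    vfBracket (X + Y) Z = vfBracket X Z + vfBracket Y Z := by
  have : CompleteSpace E := FiniteDimensional.complete ℝ E
  ext x
  exact mlieBracket_add_left (X.contMDiff.mdifferentiable (by simp) x)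
    (Y.contMDiff.mdifferentiable (by simp) x)

lemma vfBracket_self (X : VF E M) : vfBracket X X = 0 := by
  ext x
  exact congrFun (mlieBracket_self (I := 𝓘(ℝ, E)) (V := X)) x

lemma vfBracket_swap (X Y : VF E M) : vfBracket X Y = - vfBracket Y X := by
  ext x
  exact mlieBracket_swap_apply (I := 𝓘(ℝ, E)) (V := X) (W := Y)

lemma vfBracket_jacobi (X Y Z : VF E M) :
    vfBracket X (vfBracket Y Z) = vfBracket (vfBracket X Y) Z + vfBracket Y (vfBracket X Z) := by
  have : CompleteSpace E := FiniteDimensional.complete ℝ E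
  have : IsManifold 𝓘(ℝ, E) (minSmoothness ℝ 3) M := by
    rw [minSmoothness_of_isRCLikeNormedField]; infer_instance
  have h2 : minSmoothness ℝ 2 ≤ (∞ : WithTop ℕ∞) := by
    rw [minSmoothness_of_isRCLikeNormedField]
    exact WithTop.coe_le_coe.2 (le_top : (2 : ℕ∞) ≤ ⊤)
  ext x
  exact leibniz_identity_mlieBracket_apply (X.contMDiff.of_le h2 x) (Y.contMDiff.of_le h2 x)
    (Z.contMDiff.of_le h2 x)

lemma vfBracket_sub (X Y Z : VF E M) :
    vfBracket X (Y - Z) = vfBracket X Y - vfBracket X Z := by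
  rw [eq_sub_iff_add_eq, ← vfBracket_add, sub_add_cancel]

lemma sub_vfBracket (X Y Z : VF E M) :
    vfBracket (X - Y) Z = vfBracket X Z - vfBracket Y Z := by
  rw [eq_sub_iff_add_eq, ← add_vfBracket, sub_add_cancel]

lemma vfBracket_fsmul (X : VF E M) (f : Fun E M) (Y : VF E M) (x : M) :
    vfBracket X (fsmul f Y) x = f x • vfBracket X Y x + mvfderiv 𝓘(ℝ, E) f x (X x) • Y x := by
  have : CompleteSpace E := FiniteDimensional.complete ℝ E
  rw [add_comm]
  exact mlieBracket_smul_right (V := X) (f.contMDiff.mdifferentiable (by simp) x)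
    (Y.contMDiff.mdifferentiable (by simp) x)

/-- The Lie algebroid `(TM, N, [·,·]_N)` of a Nijenhuis tensor `N`: the vector bundle is `TM`, the
anchor is `N` and the bracket is the deformed bracket. -/
def nijenhuisAlgebroid (N : EndoField E M) (hN : IsNijenhuis N) :
    LieAlgebroid E E (TangentSpace 𝓘(ℝ, E) : M → Type _) where
  anchor := N
  bracket := deformedBracket N
  add_bracket X Y Z := by
    simp only [deformedBracket, applyEndo_add, add_vfBracket]
    abel
  bracket_add X Y Z := by
    simp only [deformedBracket, applyEndo_add, vfBracket_add]
    abel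
  bracket_self X := by
    have h0 : applyEndo N (0 : VF E M) = 0 := by
      ext x
      exact map_zero (N x)
    simp only [deformedBracket, vfBracket_self, h0]
    rw [vfBracket_swap X]
    abel
  jacobi X Y Z := by
    have h : ∀ U W : VF E M, vfBracket (applyEndo N U) (applyEndo N W) =
        applyEndo N (deformedBracket N U W) := fun U W => sub_eq_zero.1 (hN U W)
    have e1 := h X (vfBracket Y Z)
    have e2 := h (vfBracket X Y) Z
    have e3 := h Y (vfBracket X Z)
    have j1 := vfBracket_jacobi (applyEndo N X) (applyEndo N Y) Z
    have j2 := vfBracket_jacobi (applyEndo N X) Y (applyEndo N Z)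
    have j3 := vfBracket_jacobi X (applyEndo N Y) (applyEndo N Z)
    have k1 := congrArg (applyEndo N) (vfBracket_jacobi (applyEndo N X) Y Z)
    have k2 := congrArg (applyEndo N) (vfBracket_jacobi X (applyEndo N Y) Z)
    have k3 := congrArg (applyEndo N) (vfBracket_jacobi X Y (applyEndo N Z))
    have k4 := congrArg (fun U => applyEndo N (applyEndo N U)) (vfBracket_jacobi X Y Z)
    have d : ∀ U W : VF E M, deformedBracket N U W =
        vfBracket (applyEndo N U) W + vfBracket U (applyEndo N W) - applyEndo N (vfBracket U W) :=
      fun _ _ => rfl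
    rw [d X (deformedBracket N Y Z), d (deformedBracket N X Y) Z, d Y (deformedBracket N X Z),
      ← h Y Z, ← h X Y, ← h X Z]
    simp only [d, applyEndo_add, applyEndo_sub, vfBracket_add, vfBracket_sub, add_vfBracket,
      sub_vfBracket] at e1 e2 e3 j1 j2 j3 k1 k2 k3 k4 ⊢
    linear_combination (norm := module)
      j1 + j2 + j3 - k1 - k2 - k3 + k4 - e1 + e2 + e3
  leibniz X f Y x := by
    have h : applyEndo N (fsmul f Y) = fsmul f (applyEndo N Y) := by
      ext y
      exact map_smul (N y) (f y) (Y y)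
    have h1 := vfBracket_fsmul (applyEndo N X) f Y x
    have h2 := vfBracket_fsmul X f (applyEndo N Y) x
    have h3 := congrArg (N x) (vfBracket_fsmul X f Y x)
    rw [map_add, map_smul, map_smul] at h3
    have e : ∀ W : VF E M, deformedBracket N X W x = vfBracket (applyEndo N X) W x +
        vfBracket X (applyEndo N W) x - N x (vfBracket X W x) := fun _ => rfl
    rw [e, e, h, h1, h2, h3]
    change _ = _ + mvfderiv 𝓘(ℝ, E) f x (applyEndo N X x) • Y x
    have e' : applyEndo N Y x = N x (Y x) := rfl
    rw [e']
    module
  anchor_bracket X Y x := by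
    have h := sub_eq_zero.1 (hN X Y)
    exact (congrArg (fun U : VF E M => U x) h).symm

end Nijenhuis

end NijenhuisModular
end

/-!
The contraction `(v₁ ∧ … ∧ vₙ) ⊗ μ ↦ μ(v₁, …, vₙ)` identifies every fibre of `Λⁿ TM ⊗ Λⁿ T*M` with
`ℝ` (`contraction_injective`). Hence the line bundle is canonically trivial, whether or not `M` is
orientable (`canonicalSection`), and a nowhere vanishing section `s` is the same thing as a nowhere
vanishing smooth function `h` (`density`), locally `h = μ(e₁, …, eₙ)`.

Contracting the equation of the modular form turns it into a scalar equation
(`contraction_modular`). Since `[X, eⱼ]_N = [NX, eⱼ] + (L_X N) eⱼ`, the brackets `[NX, eⱼ]` cancel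
against those in `(L_{NX} μ)(e₁, …, eₙ)`, and there remains `⟨ξ, X⟩ h = (NX) h + Tr (L_X N) h`. As
`Tr (L_X N) = X (Tr N)` (`trace_lieEndo`), the only solution is `ξ = d Tr N + d_N log |h|`
(`isModularForm_iff`), which differs from `d Tr N` by a coboundary.

That `d Tr N` is closed uses the vanishing of the torsion in the form `L_{NX} N = N L_X N`. Its
trace is `(NX)(Tr N) = ½ X (Tr N²)`, that is `d_N Tr N = d (½ Tr N²)`, and the rest is the
commutator formula for the action of `[X, Y]` on functions, which follows from the Jacobi identity
(`derivAlong_vfBracket`).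

The Lie derivative of a form is defined through fields with constant coefficients in a chart; the
formula for arbitrary fields rests on its tensoriality (`lieDeriv_apply`).
-/

noncomputable section
namespace NijenhuisModular

/-! ### Top exterior powers -/

section TopForms
variable {V : Type*} [AddCommGroup V] [Module ℝ V] {k : ℕ}

/-- The action of an endomorphism `A` on alternating forms as a derivation,
`(A · g)(v₁, …, vₖ) = ∑ⱼ g(v₁, …, A vⱼ, …, vₖ)`. -/
def endoAction (A : V →ₗ[ℝ] V) (g : V [⋀^Fin k]→ₗ[ℝ] ℝ) : V [⋀^Fin k]→ₗ[ℝ] ℝ where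
  toFun v := ∑ j, g (Function.update v j (A (v j)))
  map_update_add' := by
    intro inst v i a b
    obtain rfl : inst = instDecidableEqFin k := Subsingleton.elim _ _
    rw [← Finset.sum_add_distrib]
    refine Finset.sum_congr rfl fun j _ => ?_
    by_cases h : j = i
    · subst h
      simp only [Function.update_self, Function.update_idem, map_add,
        AlternatingMap.map_update_add]
    · simp only [Function.update_of_ne h, Function.update_comm (Ne.symm h),
        AlternatingMap.map_update_add]
  map_update_smul' := by
    intro inst v i c a
    obtain rfl : inst = instDecidableEqFin k := Subsingleton.elim _ _
    rw [Finset.smul_sum]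
    refine Finset.sum_congr rfl fun j _ => ?_
    by_cases h : j = i
    · subst h
      simp only [Function.update_self, Function.update_idem, map_smul,
        AlternatingMap.map_update_smul]
    · simp only [Function.update_of_ne h, Function.update_comm (Ne.symm h),
        AlternatingMap.map_update_smul]
  map_eq_zero_of_eq' v i j hij hne := by
    rw [Finset.sum_eq_add i j hne]
    · have : Function.update v j (A (v j)) =
          Function.update v i (A (v i)) ∘ Equiv.swap i j := by
        funext l
        by_cases h1 : l = i
        · subst h1; simp [hne, hne.symm, hij]
        · by_cases h2 : l = j
          · subst h2; simp [hij]
          · simp [h1, h2, Equiv.swap_apply_of_ne_of_ne]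
      rw [this, g.map_swap _ hne, add_neg_cancel]
    · intro l _ hl
      exact g.map_eq_zero_of_eq _
        (by rw [Function.update_of_ne hl.1.symm, Function.update_of_ne hl.2.symm, hij]) hne
    · simp
    · simp

lemma alternating_update_basis (b : Basis (Fin k) ℝ V) (g : V [⋀^Fin k]→ₗ[ℝ] ℝ) (j : Fin k)
    (w : V) : g (Function.update b j w) = b.repr w j * g b := by
  conv_lhs => rw [← b.sum_repr w]
  rw [AlternatingMap.map_update_sum, Finset.sum_eq_single j]
  · rw [AlternatingMap.map_update_smul, Function.update_eq_self, smul_eq_mul]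
  · intro l _ hl
    rw [AlternatingMap.map_update_smul, g.map_update_self _ hl.symm, smul_zero]
  · simp

/-- An endomorphism acts on top forms, as a derivation, by multiplication with its trace. The
vectors `vⱼ` may be linearly dependent. -/
lemma sum_update_eq_trace_mul (b : Basis (Fin k) ℝ V) (A : V →ₗ[ℝ] V) (g : V [⋀^Fin k]→ₗ[ℝ] ℝ)
    (v : Fin k → V) :
    ∑ j, g (Function.update v j (A (v j))) = LinearMap.trace ℝ V A * g v := by
  change endoAction A g v = _
  have h : endoAction A g b = LinearMap.trace ℝ V A * g b := by
    change ∑ j, g (Function.update b j (A (b j))) = _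
    simp only [alternating_update_basis b g, LinearMap.trace_eq_matrix_trace ℝ b,
      Matrix.trace, Matrix.diag, LinearMap.toMatrix_apply, Finset.sum_mul]
  have h1 := congrArg (fun f => f v) ((endoAction A g).eq_smul_basis_det b)
  have h2 := congrArg (fun f => f v) (g.eq_smul_basis_det b)
  simp only [AlternatingMap.smul_apply, smul_eq_mul] at h1 h2
  rw [h1, h2, h, mul_assoc]

/-- The contraction `Λᵏ V ⊗ Λᵏ V* → ℝ`, `(v₁ ∧ … ∧ vₖ) ⊗ μ ↦ μ(v₁, …, vₖ)`. -/
def contraction : (⋀[ℝ]^k V) ⊗[ℝ] (V [⋀^Fin k]→ₗ[ℝ] ℝ) →ₗ[ℝ] ℝ :=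
  TensorProduct.lift
    (exteriorPower.alternatingMapLinearEquiv (R := ℝ) (M := V) (N := ℝ) (n := k)).toLinearMap.flip

@[simp] lemma contraction_tmul (v : Fin k → V) (μ : V [⋀^Fin k]→ₗ[ℝ] ℝ) :
    contraction (exteriorPower.ιMulti ℝ k v ⊗ₜ[ℝ] μ) = μ v := by
  simp [contraction, exteriorPower.alternatingMapLinearEquiv_apply_ιMulti]

lemma ιMulti_eq_det_smul (b : Basis (Fin k) ℝ V) (v : Fin k → V) :
    exteriorPower.ιMulti ℝ k v = b.det v • exteriorPower.ιMulti ℝ k b := by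
  have h : exteriorPower.ιMulti ℝ k (M := V) =
      (LinearMap.toSpanSingleton ℝ _ (exteriorPower.ιMulti ℝ k b)).compAlternatingMap b.det := by
    refine Basis.ext_alternating b fun σ hσ => ?_
    obtain ⟨e, rfl⟩ : ∃ e : Equiv.Perm (Fin k), ⇑e = σ :=
      ⟨Equiv.ofBijective σ (Finite.injective_iff_bijective.1 hσ), rfl⟩
    simp only [LinearMap.compAlternatingMap_apply, LinearMap.toSpanSingleton_apply]
    change exteriorPower.ιMulti ℝ k (b ∘ e) = b.det (b ∘ e) • _
    rw [AlternatingMap.map_perm, AlternatingMap.map_perm, b.det_self]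
    simp only [Units.smul_def, zsmul_eq_mul, mul_one]
    exact (Int.cast_smul_eq_zsmul ℝ _ _).symm
  exact congrArg (fun f => f v) h

lemma eq_contraction_smul (b : Basis (Fin k) ℝ V) (t : (⋀[ℝ]^k V) ⊗[ℝ] (V [⋀^Fin k]→ₗ[ℝ] ℝ)) :
    t = contraction t • (exteriorPower.ιMulti ℝ k b ⊗ₜ[ℝ] b.det) := by
  have h1 : LinearMap.id (R := ℝ) (M := ⋀[ℝ]^k V) =
      (LinearMap.toSpanSingleton ℝ _ (exteriorPower.ιMulti ℝ k b)) ∘ₗ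
        exteriorPower.alternatingMapLinearEquiv b.det := by
    refine exteriorPower.linearMap_ext (AlternatingMap.ext fun v => ?_)
    simpa [exteriorPower.alternatingMapLinearEquiv_apply_ιMulti] using ιMulti_eq_det_smul b v
  induction t with
  | zero => simp
  | add s t hs ht => rw [map_add, add_smul, ← hs, ← ht]
  | tmul l μ =>
    obtain ⟨c, rfl⟩ : ∃ c : ℝ, l = c • exteriorPower.ιMulti ℝ k b :=
      ⟨_, congrArg (fun f => f l) h1⟩
    rw [← TensorProduct.smul_tmul', map_smul, contraction_tmul, smul_assoc]
    conv_lhs => rw [μ.eq_smul_basis_det b, TensorProduct.tmul_smul]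

/-- In top degree the contraction is injective, the two exterior powers being lines. -/
lemma contraction_injective (b : Basis (Fin k) ℝ V) :
    Function.Injective (contraction (V := V) (k := k)) := by
  intro s t h
  rw [eq_contraction_smul b s, eq_contraction_smul b t, h]

end TopForms

/-! ### Local and global vector fields and top forms -/

section LocalFields
variable {E : Type*} [NormedAddCommGroup E] [NormedSpace ℝ E]
  {M : Type*} [TopologicalSpace M] [ChartedSpace E M] [IsManifold 𝓘(ℝ, E) ∞ M]

local notation "TM" => (TangentSpace 𝓘(ℝ, E) : M → Type _)

lemma continuousAlternatingMap_contDiff_uncurry {k : ℕ} :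
    ContDiff ℝ ∞ (fun p : (E [⋀^Fin k]→L[ℝ] ℝ) × (Fin k → E) => p.1 p.2) := by
  have h := (ContinuousAlternatingMap.toContinuousMultilinearMapCLM (𝕜 := ℝ) (E := E) (F := ℝ)
    (ι := Fin k) ℝ).analyticOnNhd_uncurry_of_multilinear (s := Set.univ)
  exact contDiffOn_univ.1 (h.contDiffOn uniqueDiffOn_univ)

/-- Evaluation of a form on vector fields, read in the trivialization around `x`. -/
lemma formAt_eq_inCoordinates {k : ℕ} (μ : Form E M k)
    (Z : Fin k → Π y : M, TangentSpace 𝓘(ℝ, E) y)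
    (x : M) : ∀ᶠ y in 𝓝 x, formAt μ y (fun i => Z i y) =
      (ContinuousAlternatingMap.inCoordinates (E₁ := TM) (E₂ := Bundle.Trivial M ℝ) E ℝ x y x y
        (μ y)) (fun i => (trivializationAt E TM x ⟨y, Z i y⟩).2) := by
  filter_upwards [(trivializationAt E TM x).open_baseSet.mem_nhds
    (FiberBundle.mem_baseSet_trivializationAt' x)] with y hy
  simp only [formAt, ContinuousAlternatingMap.inCoordinates]
  simp only [ContinuousAlternatingMap.compContinuousLinearMap_apply, Function.comp_def]
  have : ∀ i, (trivializationAt E TM x).symmL ℝ y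
      (trivializationAt E TM x ⟨y, Z i y⟩).2 = Z i y := by
    intro i
    rw [← Trivialization.continuousLinearMapAt_apply_of_mem (R := ℝ) _ hy,
      Trivialization.symmL_continuousLinearMapAt _ hy]
  simp [this]

lemma contMDiffAt_formAt_apply {k : ℕ} (μ : Form E M k) {x : M}
    {Z : Fin k → Π y : M, TangentSpace 𝓘(ℝ, E) y}
    (hZ : ∀ i, ContMDiffAt 𝓘(ℝ, E) (𝓘(ℝ, E).prod 𝓘(ℝ, E)) ∞
      (fun y => (⟨y, Z i y⟩ : TangentBundle 𝓘(ℝ, E) M)) x) :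
    ContMDiffAt 𝓘(ℝ, E) 𝓘(ℝ, ℝ) ∞ (fun y => formAt μ y (fun i => Z i y)) x := by
  have h1 := contMDiffAt_section _ |>.1 (μ.contMDiff x)
  have h2 : ContMDiffAt 𝓘(ℝ, E) 𝓘(ℝ, Fin k → E) ∞
      (fun y i => (trivializationAt E TM x ⟨y, Z i y⟩).2) x :=
    contMDiffAt_pi_space.2 fun i => contMDiffAt_section _ |>.1 (hZ i)
  exact (continuousAlternatingMap_contDiff_uncurry.contMDiff.contMDiffAt.comp x
    (h1.prodMk_space h2)).congr_of_eventuallyEq (formAt_eq_inCoordinates μ Z x)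

lemma mdifferentiableAt_formAt_apply {k : ℕ} (μ : Form E M k) {x : M}
    {Z : Fin k → Π y : M, TangentSpace 𝓘(ℝ, E) y}
    (hZ : ∀ i, MDifferentiableAt 𝓘(ℝ, E) (𝓘(ℝ, E).prod 𝓘(ℝ, E))
      (fun y => (⟨y, Z i y⟩ : TangentBundle 𝓘(ℝ, E) M)) x) :
    MDifferentiableAt 𝓘(ℝ, E) 𝓘(ℝ, ℝ) (fun y => formAt μ y (fun i => Z i y)) x := by
  have h1 := (contMDiffAt_section _ |>.1 (μ.contMDiff x)).mdifferentiableAt (by simp)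
  have h2 : MDifferentiableAt 𝓘(ℝ, E) 𝓘(ℝ, Fin k → E)
      (fun y i => (trivializationAt E TM x ⟨y, Z i y⟩).2) x :=
    have h i := mdifferentiableAt_section _ _ |>.1 (hZ i)
    ⟨continuousWithinAt_pi.2 fun i => (h i).1, differentiableWithinAt_pi.2 fun i => (h i).2⟩
  exact (((continuousAlternatingMap_contDiff_uncurry.contMDiff.contMDiffAt.mdifferentiableAt
    (by simp)).comp x (h1.prodMk_space h2)).congr_of_eventuallyEq (formAt_eq_inCoordinates μ Z x))

lemma contMDiffOn_coordField {x : M} (v : TangentSpace 𝓘(ℝ, E) x) :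
    ContMDiffOn 𝓘(ℝ, E) (𝓘(ℝ, E).prod 𝓘(ℝ, E)) ∞
      (fun y => (⟨y, coordField v y⟩ : TangentBundle 𝓘(ℝ, E) M))
      (trivializationAt E TM x).baseSet := by
  refine (Trivialization.contMDiffOn_section_baseSet_iff (trivializationAt E TM x)).2 ?_
  refine (contMDiffOn_const (c := (trivializationAt E TM x).continuousLinearMapAt ℝ x v)).congr
    fun y hy => ?_
  rw [← Trivialization.continuousLinearMapAt_apply_of_mem (R := ℝ) _ hy]
  exact Trivialization.continuousLinearMapAt_symmL _ hy _

end LocalFields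

section Globalization
variable {E : Type*} [NormedAddCommGroup E] [NormedSpace ℝ E] [FiniteDimensional ℝ E]
  {M : Type*} [TopologicalSpace M] [T2Space M] [ChartedSpace E M] [IsManifold 𝓘(ℝ, E) ∞ M]

local notation "TM" => (TangentSpace 𝓘(ℝ, E) : M → Type _)

/-- On a Hausdorff manifold there are smooth functions that are `1` near a point and whose support
lies in a given neighbourhood. -/
lemma exists_bump {x : M} {u : Set M} (hu : u ∈ 𝓝 x) :
    ∃ φ : Fun E M, (∀ᶠ y in 𝓝 x, φ y = 1) ∧ tsupport φ ⊆ u := by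
  obtain ⟨f, -, hf⟩ := (SmoothBumpFunction.nhds_basis_tsupport (I := 𝓘(ℝ, E)) x).mem_iff.1 hu
  exact ⟨⟨f, f.contMDiff⟩, f.eventuallyEq_one, hf⟩

lemma exists_vf_eventuallyEq_coordField {x : M} (v : TangentSpace 𝓘(ℝ, E) x) :
    ∃ Z : VF E M, ∀ᶠ y in 𝓝 x, Z y = coordField v y := by
  have ho := (trivializationAt E TM x).open_baseSet
  obtain ⟨φ, h1, hs⟩ := exists_bump (E := E) (ho.mem_nhds
    (FiberBundle.mem_baseSet_trivializationAt' x))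
  refine ⟨⟨_, ContMDiffOn.smul_section_of_tsupport φ.contMDiff.contMDiffOn ho hs
    (contMDiffOn_coordField v)⟩, ?_⟩
  filter_upwards [h1] with y hy
  change φ y • coordField v y = _
  rw [hy, one_smul]

lemma exists_vf_apply_eq {x : M} (v : TangentSpace 𝓘(ℝ, E) x) : ∃ Z : VF E M, Z x = v := by
  obtain ⟨Z, hZ⟩ := exists_vf_eventuallyEq_coordField v
  exact ⟨Z, hZ.self_of_nhds.trans (coordField_self v)⟩

end Globalization

/-! ### Tensoriality of Lie derivatives -/

section Tensoriality
variable {E : Type*} [NormedAddCommGroup E] [NormedSpace ℝ E] [FiniteDimensional ℝ E]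
  {M : Type*} [TopologicalSpace M] [ChartedSpace E M] [IsManifold 𝓘(ℝ, E) ∞ M]

local notation "TM" => (TangentSpace 𝓘(ℝ, E) : M → Type _)

lemma update_fields_apply {k : ℕ} (Z : Fin k → Π y : M, TangentSpace 𝓘(ℝ, E) y) (i : Fin k)
    (σ : Π y : M, TangentSpace 𝓘(ℝ, E) y) (y : M) :
    (fun j => Function.update Z i σ j y) = Function.update (fun j => Z j y) i (σ y) := by
  funext j
  by_cases h : j = i
  · subst h; simp
  · simp [h]

lemma mdifferentiableAt_update_fields {k : ℕ} {x : M}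
    {Z : Fin k → Π y : M, TangentSpace 𝓘(ℝ, E) y}
    (hZ : ∀ i, MDifferentiableAt 𝓘(ℝ, E) (𝓘(ℝ, E).prod 𝓘(ℝ, E))
      (fun y => (⟨y, Z i y⟩ : TangentBundle 𝓘(ℝ, E) M)) x) (i : Fin k)
    {σ : Π y : M, TangentSpace 𝓘(ℝ, E) y}
    (hσ : MDifferentiableAt 𝓘(ℝ, E) (𝓘(ℝ, E).prod 𝓘(ℝ, E))
      (fun y => (⟨y, σ y⟩ : TangentBundle 𝓘(ℝ, E) M)) x) (j : Fin k) :
    MDifferentiableAt 𝓘(ℝ, E) (𝓘(ℝ, E).prod 𝓘(ℝ, E))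
      (fun y => (⟨y, Function.update Z i σ j y⟩ : TangentBundle 𝓘(ℝ, E) M)) x := by
  by_cases h : j = i
  · subst h; simpa using hσ
  · simpa [h] using hZ j

/-- The formula for `(L_Y μ)(Z₁, …, Zₖ)` is tensorial in each `Zᵢ`. -/
lemma tensorialAt_lieDerivEval {k : ℕ} (Y : VF E M) (μ : Form E M k) {x : M}
    {Z : Fin k → Π y : M, TangentSpace 𝓘(ℝ, E) y}
    (hZ : ∀ i, MDifferentiableAt 𝓘(ℝ, E) (𝓘(ℝ, E).prod 𝓘(ℝ, E))
      (fun y => (⟨y, Z i y⟩ : TangentBundle 𝓘(ℝ, E) M)) x) (i : Fin k) :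
    TensorialAt 𝓘(ℝ, E) E
      (fun σ : Π y : M, TangentSpace 𝓘(ℝ, E) y =>
        lieDerivEval Y μ x (Function.update Z i σ)) x where
  smul {f σ} hf hσ := by
    have : CompleteSpace E := FiniteDimensional.complete ℝ E
    have e1 := mdifferentiableAt_formAt_apply μ (mdifferentiableAt_update_fields hZ i hσ)
    have hd : (fun y => formAt μ y (fun j => Function.update Z i (f • σ) j y)) =
        f • (fun y => formAt μ y (fun j => Function.update Z i σ j y)) := by
      funext y
      simp only [update_fields_apply, Pi.smul_apply', AlternatingMap.map_update_smul]
    have hs : ∀ l, formAt μ x (Function.update (fun j => Function.update Z i (f • σ) j x) l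
          (mlieBracket 𝓘(ℝ, E) Y (Function.update Z i (f • σ) l) x)) =
        f x * formAt μ x (Function.update (fun j => Function.update Z i σ j x) l
          (mlieBracket 𝓘(ℝ, E) Y (Function.update Z i σ l) x)) +
        if l = i then mvfderiv 𝓘(ℝ, E) f x (Y x) *
          formAt μ x (Function.update (fun j => Z j x) i (σ x)) else 0 := by
      intro l
      simp only [update_fields_apply]
      by_cases h : l = i
      · subst h
        simp only [Function.update_self, Function.update_idem, if_true]
        rw [mlieBracket_smul_right hf hσ, AlternatingMap.map_update_add,
          AlternatingMap.map_update_smul, AlternatingMap.map_update_smul, add_comm]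
        rfl
      · simp only [Function.update_of_ne h, if_neg h, add_zero, Pi.smul_apply']
        simp only [Function.update_comm (Ne.symm h), AlternatingMap.map_update_smul, smul_eq_mul]
    have hsum := Finset.sum_congr rfl fun l (_ : l ∈ Finset.univ) => hs l
    rw [Finset.sum_add_distrib, ← Finset.mul_sum, Finset.sum_ite_eq', if_pos (Finset.mem_univ i)]
      at hsum
    simp only [lieDerivEval]
    rw [hsum, hd, mvfderiv_smul hf e1, update_fields_apply Z i σ x]
    simp only [add_apply, smul_apply, ContinuousLinearMap.smulRight_apply, smul_eq_mul]
    ring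
  add {σ τ} hσ hτ := by
    have : CompleteSpace E := FiniteDimensional.complete ℝ E
    have e1 := mdifferentiableAt_formAt_apply μ (mdifferentiableAt_update_fields hZ i hσ)
    have e2 := mdifferentiableAt_formAt_apply μ (mdifferentiableAt_update_fields hZ i hτ)
    have hd : (fun y => formAt μ y (fun j => Function.update Z i (σ + τ) j y)) =
        (fun y => formAt μ y (fun j => Function.update Z i σ j y)) +
        (fun y => formAt μ y (fun j => Function.update Z i τ j y)) := by
      funext y
      simp only [update_fields_apply, Pi.add_apply, AlternatingMap.map_update_add]
    have hs : ∀ l, formAt μ x (Function.update (fun j => Function.update Z i (σ + τ) j x) l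
          (mlieBracket 𝓘(ℝ, E) Y (Function.update Z i (σ + τ) l) x)) =
        formAt μ x (Function.update (fun j => Function.update Z i σ j x) l
          (mlieBracket 𝓘(ℝ, E) Y (Function.update Z i σ l) x)) +
        formAt μ x (Function.update (fun j => Function.update Z i τ j x) l
          (mlieBracket 𝓘(ℝ, E) Y (Function.update Z i τ l) x)) := by
      intro l
      simp only [update_fields_apply]
      by_cases h : l = i
      · subst h
        simp only [Function.update_self, Function.update_idem]
        rw [mlieBracket_add_right hσ hτ, AlternatingMap.map_update_add]
      · simp only [Function.update_of_ne h, Pi.add_apply]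
        simp only [Function.update_comm (Ne.symm h), AlternatingMap.map_update_add]
    simp only [lieDerivEval]
    rw [hd, mvfderiv_add e1 e2]
    simp only [hs, Finset.sum_add_distrib, add_apply]
    ring

/-- The Lie derivative of a form can be computed with arbitrary vector fields in place of fields
with constant coefficients. -/
lemma lieDeriv_apply {k : ℕ} (Y : VF E M) (μ : Form E M k) {x : M}
    {Z : Fin k → Π y : M, TangentSpace 𝓘(ℝ, E) y}
    (hZ : ∀ i, MDifferentiableAt 𝓘(ℝ, E) (𝓘(ℝ, E).prod 𝓘(ℝ, E))
      (fun y => (⟨y, Z i y⟩ : TangentBundle 𝓘(ℝ, E) M)) x) :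
    lieDeriv Y μ x (fun i => Z i x) = lieDerivEval Y μ x Z := by
  classical
  have hc (i) : MDifferentiableAt 𝓘(ℝ, E) (𝓘(ℝ, E).prod 𝓘(ℝ, E))
      (fun y => (⟨y, coordField (Z i x) y⟩ : TangentBundle 𝓘(ℝ, E) M)) x :=
    (contMDiffAt_coordField (Z i x)).mdifferentiableAt (by simp)
  -- The slots are changed from `coordField (Z i x)` to `Z i` one at a time.
  let W (s : Finset (Fin k)) (i : Fin k) : Π y : M, TangentSpace 𝓘(ℝ, E) y :=
    if i ∈ s then Z i else coordField (Z i x)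
  have hW (s i) : MDifferentiableAt 𝓘(ℝ, E) (𝓘(ℝ, E).prod 𝓘(ℝ, E))
      (fun y => (⟨y, W s i y⟩ : TangentBundle 𝓘(ℝ, E) M)) x := by
    by_cases h : i ∈ s
    · simpa [W, h] using hZ i
    · simpa [W, h] using hc i
  have key (s : Finset (Fin k)) : lieDerivEval Y μ x (W s) = lieDerivEval Y μ x (W ∅) := by
    induction s using Finset.induction_on with
    | empty => rfl
    | insert a s ha ih =>
      have h1 : W (insert a s) = Function.update (W s) a (Z a) := by
        funext j
        by_cases h : j = a
        · subst h; simp [W]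
        · simp [W, h]
      have h2 : W s = Function.update (W s) a (coordField (Z a x)) := by
        funext j
        by_cases h : j = a
        · subst h; simp [W, ha]
        · simp [h]
      rw [← ih, h1]
      conv_rhs => rw [h2]
      exact (tensorialAt_lieDerivEval Y μ (hW s) a).pointwise (hZ a) (hc a)
        (coordField_self _).symm
  have h0 : W ∅ = fun i => coordField (Z i x) := by funext i; simp [W]
  have h1 : W Finset.univ = Z := by funext i; simp [W]
  have h2 := key Finset.univ
  rw [h1, h0] at h2
  exact h2.symm

lemma mdifferentiableAt_endo_apply (N : EndoField E M) {x : M}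
    {Z : Π y : M, TangentSpace 𝓘(ℝ, E) y}
    (hZ : MDifferentiableAt 𝓘(ℝ, E) (𝓘(ℝ, E).prod 𝓘(ℝ, E))
      (fun y => (⟨y, Z y⟩ : TangentBundle 𝓘(ℝ, E) M)) x) :
    MDifferentiableAt 𝓘(ℝ, E) (𝓘(ℝ, E).prod 𝓘(ℝ, E))
      (fun y => (⟨y, N y (Z y)⟩ : TangentBundle 𝓘(ℝ, E) M)) x :=
  MDifferentiableAt.clm_bundle_apply (b := id)
    (N.contMDiff.mdifferentiable (by simp) x) hZ

/-- `(L_X N) Z = [X, N Z] - N [X, Z]` is tensorial in `Z`. -/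
lemma tensorialAt_lieEndo (X : VF E M) (N : EndoField E M) (x : M) :
    TensorialAt 𝓘(ℝ, E) E (fun Z : Π y : M, TangentSpace 𝓘(ℝ, E) y =>
      mlieBracket 𝓘(ℝ, E) X (fun y => N y (Z y)) x - N x (mlieBracket 𝓘(ℝ, E) X Z x)) x where
  smul {f σ} hf hσ := by
    have : CompleteSpace E := FiniteDimensional.complete ℝ E
    have h : (fun y => N y ((f • σ) y)) = f • (fun y => N y (σ y)) := by
      funext y
      exact map_smul (N y) (f y) (σ y)
    rw [h, mlieBracket_smul_right hf hσ,
      mlieBracket_smul_right hf (mdifferentiableAt_endo_apply N hσ), map_add, map_smul, map_smul]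
    module
  add {σ τ} hσ hτ := by
    have : CompleteSpace E := FiniteDimensional.complete ℝ E
    have h : (fun y => N y ((σ + τ) y)) = (fun y => N y (σ y)) + (fun y => N y (τ y)) := by
      funext y
      exact map_add (N y) (σ y) (τ y)
    rw [h, mlieBracket_add_right hσ hτ, mlieBracket_add_right (mdifferentiableAt_endo_apply N hσ)
      (mdifferentiableAt_endo_apply N hτ), map_add]
    abel

/-- The value at `x` of the Lie derivative `L_X N` of a `(1,1)`-tensor. -/
def lieEndo (X : VF E M) (N : EndoField E M) (x : M) :
    TangentSpace 𝓘(ℝ, E) x →L[ℝ] TangentSpace 𝓘(ℝ, E) x :=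
  TensorialAt.mkHom (I := 𝓘(ℝ, E)) (F := E) _ x (tensorialAt_lieEndo X N x)

lemma lieEndo_apply (X : VF E M) (N : EndoField E M) (Z : VF E M) (x : M) :
    lieEndo X N x (Z x) = vfBracket X (applyEndo N Z) x - N x (vfBracket X Z x) :=
  TensorialAt.mkHom_apply (tensorialAt_lieEndo X N x) (Z.contMDiff.mdifferentiable (by simp) x)

end Tensoriality

/-! ### Local volume forms and the canonical section -/

section Volume
variable {E : Type*} [NormedAddCommGroup E] [NormedSpace ℝ E] [FiniteDimensional ℝ E]
  {M : Type*} [TopologicalSpace M] [ChartedSpace E M] [IsManifold 𝓘(ℝ, E) ∞ M]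

local notation "TM" => (TangentSpace 𝓘(ℝ, E) : M → Type _)

variable (E) in
/-- The determinant with respect to the standard basis of the model space, as a continuous
alternating form. -/
def modelVolume : E [⋀^Fin (finrank ℝ E)]→L[ℝ] ℝ :=
  { (finBasis ℝ E).det with
    cont := by
      change Continuous fun v => (finBasis ℝ E).det v
      simp only [Basis.det_apply]
      refine Continuous.matrix_det (continuous_matrix fun i j => ?_)
      exact ((finBasis ℝ E).coord i).continuous_of_finiteDimensional.comp (continuous_apply j) }

lemma modelVolume_basis : modelVolume E (finBasis ℝ E) = 1 := (finBasis ℝ E).det_self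

lemma eq_smul_modelVolume (g : E [⋀^Fin (finrank ℝ E)]→L[ℝ] ℝ) :
    g = g (finBasis ℝ E) • modelVolume E := by
  ext v
  exact congrArg (fun f => f v) (g.toAlternatingMap.eq_smul_basis_det (finBasis ℝ E))

/-- A field of top forms is smooth at `x` as soon as its value on a frame with constant
coefficients around `x` is. -/
lemma contMDiffAt_topForm {x : M}
    {η : Π y : M, TangentSpace 𝓘(ℝ, E) y [⋀^Fin (finrank ℝ E)]→L[ℝ] Bundle.Trivial M ℝ y}
    (h : ContMDiffAt 𝓘(ℝ, E) 𝓘(ℝ, ℝ) ∞ (fun y => (η y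
      (fun i => (trivializationAt E TM x).symmL ℝ y (finBasis ℝ E i)) : ℝ)) x) :
    ContMDiffAt 𝓘(ℝ, E) (𝓘(ℝ, E).prod 𝓘(ℝ, E [⋀^Fin (finrank ℝ E)]→L[ℝ] ℝ)) ∞
      (fun y => TotalSpace.mk' (E [⋀^Fin (finrank ℝ E)]→L[ℝ] ℝ)
        (E := fun y : M => TangentSpace 𝓘(ℝ, E) y [⋀^Fin (finrank ℝ E)]→L[ℝ] Bundle.Trivial M ℝ y)
        y (η y)) x := by
  refine (contMDiffAt_section _).2 ?_
  refine (h.smul (contMDiffAt_const (c := modelVolume E))).congr_of_eventuallyEq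
    (.of_forall fun y => ?_)
  refine (eq_smul_modelVolume _).trans ?_
  congr 1
  change (ContinuousAlternatingMap.inCoordinates (E₁ := TM) (E₂ := Bundle.Trivial M ℝ) E ℝ x y x y
    (η y)) (finBasis ℝ E) = _
  simp [ContinuousAlternatingMap.inCoordinates, Function.comp_def]

/-- Near every point there is a frame of smooth vector fields and a smooth top form whose value on
the frame is `1`. -/
lemma exists_frame_topForm [T2Space M] (x₀ : M) :
    ∃ (e : Fin (finrank ℝ E) → VF E M) (μ : Form E M (finrank ℝ E)),
      ∀ᶠ y in 𝓝 x₀, formAt μ y (fun i => e i y) = 1 := by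
  set t := trivializationAt E TM x₀
  have ho : IsOpen t.baseSet := t.open_baseSet
  have hx₀ : x₀ ∈ t.baseSet := FiberBundle.mem_baseSet_trivializationAt' x₀
  obtain ⟨φ, h1, hs⟩ := exists_bump (E := E) (ho.mem_nhds hx₀)
  let μ : Form E M (finrank ℝ E) := ⟨fun y =>
    (φ y • (modelVolume E).compContinuousLinearMap (t.continuousLinearMapAt ℝ y) :
      TangentSpace 𝓘(ℝ, E) y [⋀^Fin (finrank ℝ E)]→L[ℝ] ℝ), by
    intro x
    refine contMDiffAt_topForm ?_
    by_cases hx : x ∈ t.baseSet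
    · have hx' : x ∈ (trivializationAt E TM x).baseSet :=
        FiberBundle.mem_baseSet_trivializationAt' x
      refine φ.contMDiff.contMDiffAt.smul ?_
      have h2 : ContMDiffAt 𝓘(ℝ, E) 𝓘(ℝ, Fin (finrank ℝ E) → E) ∞ (fun y i =>
          t.continuousLinearMapAt ℝ y
            ((trivializationAt E TM x).symmL ℝ y (finBasis ℝ E i))) x := by
        refine contMDiffAt_pi_space.2 fun i => ?_
        have h3 := (t.contMDiffAt_section_iff hx).1
          (contMDiffAt_coordField ((trivializationAt E TM x).symmL ℝ x (finBasis ℝ E i)))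
        refine h3.congr_of_eventuallyEq ?_
        filter_upwards [ho.mem_nhds hx] with y hy
        rw [← Trivialization.continuousLinearMapAt_apply_of_mem (R := ℝ) _ hy, coordField,
          Trivialization.continuousLinearMapAt_symmL _ hx']
      exact (continuousAlternatingMap_contDiff_uncurry.contMDiff.contMDiffAt).comp x
        (contMDiffAt_const (c := modelVolume E) |>.prodMk_space h2)
    · refine (contMDiffAt_const (c := (0 : ℝ))).congr_of_eventuallyEq ?_
      filter_upwards [(isClosed_tsupport φ).isOpen_compl.mem_nhds fun h => hx (hs h)] with y hy
      have h0 : φ y = 0 := image_eq_zero_of_notMem_tsupport hy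
      rw [h0, zero_smul]
      rfl⟩
  choose e he using fun i => exists_vf_eventuallyEq_coordField (E := E)
    (t.symmL ℝ x₀ (finBasis ℝ E i))
  refine ⟨e, μ, ?_⟩
  filter_upwards [h1, ho.mem_nhds hx₀, Filter.eventually_all.2 he] with y hy hty hey
  change φ y • modelVolume E (fun i => t.continuousLinearMapAt ℝ y (e i y)) = 1
  rw [hy, one_smul, ← modelVolume_basis (E := E)]
  congr 1
  funext i
  rw [hey i, coordField, Trivialization.continuousLinearMapAt_symmL _ hx₀,
    Trivialization.continuousLinearMapAt_symmL _ hty]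

/-- A basis of the tangent space at `x`. -/
def tangentBasis (x : M) : Basis (Fin (finrank ℝ E)) ℝ (TangentSpace 𝓘(ℝ, E) x) :=
  (finBasis ℝ E : Basis (Fin (finrank ℝ E)) ℝ E)

/-- The canonical section of `Λⁿ TM ⊗ Λⁿ T*M`, the one with contraction `1`. It is nowhere zero
whether or not `M` is orientable. -/
def canonicalSection [T2Space M] : TopSection E E TM where
  toFun x := exteriorPower.ιMulti ℝ _ (tangentBasis x) ⊗ₜ[ℝ] (tangentBasis x).det
  smooth x := by
    obtain ⟨e, μ, h⟩ := exists_frame_topForm (E := E) x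
    refine ⟨e, μ, ?_⟩
    filter_upwards [h] with y hy
    refine contraction_injective (tangentBasis y) ?_
    rw [contraction_tmul, Basis.det_self, wedge, contraction_tmul, hy]
  ne_zero x h := by
    have := congrArg contraction h
    rw [contraction_tmul, Basis.det_self, map_zero] at this
    exact one_ne_zero this

end Volume

/-! ### Vector fields as derivations -/

section Derivations
variable {E : Type*} [NormedAddCommGroup E] [NormedSpace ℝ E] [FiniteDimensional ℝ E]
  {M : Type*} [TopologicalSpace M] [ChartedSpace E M] [IsManifold 𝓘(ℝ, E) ∞ M]

local notation "TM" => (TangentSpace 𝓘(ℝ, E) : M → Type _)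

/-- The derivative `X f` of a smooth function along a vector field. -/
def derivAlong (X : VF E M) (f : Fun E M) : Fun E M :=
  ⟨pairing (differential f) X, contMDiff_pairing _ _⟩

lemma derivAlong_apply (X : VF E M) (f : Fun E M) (x : M) :
    derivAlong X f x = mvfderiv 𝓘(ℝ, E) f x (X x) := rfl

lemma vfBracket_fsmul_eq (X : VF E M) (f : Fun E M) (Y : VF E M) :
    vfBracket X (fsmul f Y) = fsmul f (vfBracket X Y) + fsmul (derivAlong X f) Y := by
  ext x
  exact vfBracket_fsmul X f Y x

/-- `[X, Y]` acts on functions as the commutator of `X` and `Y`. This is read off from the Jacobi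
identity for `X`, `Y` and `f Z`, with `Z` not vanishing at the given point. -/
lemma derivAlong_vfBracket [T2Space M] (X Y : VF E M) (f : Fun E M) (x : M) :
    derivAlong (vfBracket X Y) f x =
      derivAlong X (derivAlong Y f) x - derivAlong Y (derivAlong X f) x := by
  -- In dimension zero there is no such `Z`, but both sides are zero.
  rcases subsingleton_or_nontrivial E with hE | hE
  · have h0 (W : VF E M) (g : Fun E M) : derivAlong W g x = 0 := by
      have : W x = 0 := Subsingleton.elim (α := E) _ _
      rw [derivAlong_apply, this, map_zero]
    simp only [h0, sub_zero]
  · obtain ⟨v, hv⟩ := exists_ne (0 : E)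
    obtain ⟨Z, hZ⟩ := exists_vf_apply_eq (E := E) (x := x) v
    have h := congrArg (fun W : VF E M => W x) (vfBracket_jacobi X Y (fsmul f Z))
    have hj := congrArg (fun W : VF E M => W x) (vfBracket_jacobi X Y Z)
    simp only [vfBracket_fsmul_eq, vfBracket_add] at h
    have hs (g : Fun E M) (W : VF E M) : (fsmul g W) x = g x • W x := rfl
    simp only [ContMDiffSection.coe_add, Pi.add_apply, hs] at h hj
    rw [hj] at h
    have h2 : (derivAlong (vfBracket X Y) f x -
      (derivAlong X (derivAlong Y f) x - derivAlong Y (derivAlong X f) x)) •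
        Z x = 0 := by
      linear_combination (norm := module) -h
    have hv : Z x ≠ 0 := by rw [hZ]; exact hv
    exact sub_eq_zero.1 ((smul_eq_zero.1 h2).resolve_right hv)

lemma mvfderiv_finset_sum {ι : Type*} (s : Finset ι) {f : ι → M → ℝ} {x : M}
    (hf : ∀ i, MDifferentiableAt 𝓘(ℝ, E) 𝓘(ℝ, ℝ) (f i) x) (v : TangentSpace 𝓘(ℝ, E) x) :
    mvfderiv 𝓘(ℝ, E) (fun y => ∑ i ∈ s, f i y) x v = ∑ i ∈ s, mvfderiv 𝓘(ℝ, E) (f i) x v := by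
  classical
  have key : MDifferentiableAt 𝓘(ℝ, E) 𝓘(ℝ, ℝ) (fun y => ∑ i ∈ s, f i y) x ∧
      mvfderiv 𝓘(ℝ, E) (fun y => ∑ i ∈ s, f i y) x v =
        ∑ i ∈ s, mvfderiv 𝓘(ℝ, E) (f i) x v := by
    induction s using Finset.induction_on with
    | empty =>
      simp only [Finset.sum_empty]
      exact ⟨mdifferentiableAt_const, by rw [mvfderiv_const]; rfl⟩
    | insert a s ha ih =>
      simp only [Finset.sum_insert ha]
      refine ⟨(hf a).add ih.1, ?_⟩
      rw [← ih.2]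
      exact congrArg (fun T => T v) (mvfderiv_add (hf a) ih.1)
  exact key.2

end Derivations

/-! ### The trace of a Lie derivative -/

section Trace
variable {E : Type*} [NormedAddCommGroup E] [NormedSpace ℝ E] [FiniteDimensional ℝ E]
  {M : Type*} [TopologicalSpace M] [ChartedSpace E M] [IsManifold 𝓘(ℝ, E) ∞ M]

/-- The Leibniz rule for the Lie derivative of `μ(Z₁, …, Zₖ)`. -/
lemma mvfderiv_formAt_apply {k : ℕ} (X : VF E M) (μ : Form E M k) (Z : Fin k → VF E M) (x : M) :
    mvfderiv 𝓘(ℝ, E) (fun y => formAt μ y (fun i => Z i y)) x (X x) =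
      lieDeriv X μ x (fun i => Z i x) +
        ∑ i, formAt μ x (Function.update (fun j => Z j x) i (vfBracket X (Z i) x)) := by
  rw [lieDeriv_apply X μ (Z := fun i => Z i) fun i => (Z i).contMDiff.mdifferentiable (by simp) x,
    lieDerivEval]
  exact (sub_add_cancel _ _).symm

lemma sum_update_endo_eq_trace_mul {x : M}
    (A : TangentSpace 𝓘(ℝ, E) x →L[ℝ] TangentSpace 𝓘(ℝ, E) x)
    (g : TangentSpace 𝓘(ℝ, E) x [⋀^Fin (finrank ℝ E)]→ₗ[ℝ] ℝ)
    (v : Fin (finrank ℝ E) → TangentSpace 𝓘(ℝ, E) x) :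
    ∑ j, g (Function.update v j (A (v j))) = LinearMap.trace ℝ (TangentSpace 𝓘(ℝ, E) x) A * g v :=
  sum_update_eq_trace_mul (tangentBasis x) (A : TangentSpace 𝓘(ℝ, E) x →ₗ[ℝ] _) g v

/-- `Tr (L_X N) = X (Tr N)`: differentiate `∑ⱼ μ(e₁, …, N eⱼ, …, eₙ) = (Tr N) μ(e₁, …, eₙ)` along
`X`. -/
lemma trace_lieEndo [T2Space M] (X : VF E M) (N : EndoField E M) (x : M) :
    LinearMap.trace ℝ (TangentSpace 𝓘(ℝ, E) x) (lieEndo X N x) = derivAlong X (traceFun N) x := by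
  obtain ⟨e, μ, hμ⟩ := exists_frame_topForm (E := E) x
  have h1 : formAt μ x (fun i => e i x) = 1 := hμ.self_of_nhds
  let Z (j : Fin (finrank ℝ E)) : Fin (finrank ℝ E) → VF E M :=
    Function.update e j (applyEndo N (e j))
  have hZ (j y) : (fun i => Z j i y) = Function.update (fun i => e i y) j (N y (e j y)) := by
    funext i
    by_cases h : i = j
    · subst h; simp only [Z, Function.update_self]; rfl
    · simp [Z, h]
  have hd (W : Fin (finrank ℝ E) → VF E M) : MDifferentiableAt 𝓘(ℝ, E) 𝓘(ℝ, ℝ)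
      (fun y => formAt μ y (fun i => W i y)) x :=
    mdifferentiableAt_formAt_apply μ fun i => (W i).contMDiff.mdifferentiable (by simp) x
  have hf : (fun y => ∑ j, formAt μ y (fun i => Z j i y)) =
      (traceFun N : M → ℝ) • fun y => formAt μ y (fun i => e i y) := by
    funext y
    simp only [hZ]
    exact sum_update_endo_eq_trace_mul (N y) (formAt μ y) _
  have hL := mvfderiv_finset_sum Finset.univ (fun j => hd (Z j)) (X x)
  rw [hf, mvfderiv_smul ((traceFun N).contMDiff.mdifferentiable (by simp) x) (hd e)] at hL
  simp only [mvfderiv_formAt_apply, Finset.sum_add_distrib] at hL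
  let w (i : Fin (finrank ℝ E)) : TangentSpace 𝓘(ℝ, E) x := vfBracket X (e i) x
  let v (i : Fin (finrank ℝ E)) : Fin (finrank ℝ E) → TangentSpace 𝓘(ℝ, E) x :=
    Function.update (fun l => e l x) i (w i)
  -- Each `[X, N eⱼ]` is split as `(L_X N) eⱼ + N [X, eⱼ]`.
  have hterm (j i : Fin (finrank ℝ E)) :
      formAt μ x (Function.update (fun l => Z j l x) i (vfBracket X (Z j i) x)) =
        formAt μ x (Function.update (v i) j (N x (v i j))) +
          if i = j then formAt μ x (Function.update (fun l => e l x) j (lieEndo X N x (e j x)))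
            else 0 := by
    rw [hZ]
    by_cases h : i = j
    · subst h
      have h2 : vfBracket X (Z i i) x = N x (w i) + lieEndo X N x (e i x) := by
        simp only [Z, Function.update_self, lieEndo_apply, w]
        abel
      simp only [v, h2, Function.update_idem, Function.update_self, if_true,
        AlternatingMap.map_update_add]
    · have h2 : v i j = e j x := Function.update_of_ne (Ne.symm h) _ _
      have h3 : Z j i = e i := Function.update_of_ne h _ _
      rw [if_neg h, add_zero, h2, h3, Function.update_comm (Ne.symm h)]
  have hsum : ∑ j, ∑ i, formAt μ x (Function.update (fun l => Z j l x) i (vfBracket X (Z j i) x)) =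
      LinearMap.trace ℝ (TangentSpace 𝓘(ℝ, E) x) (N x) * ∑ i, formAt μ x (v i) +
        LinearMap.trace ℝ (TangentSpace 𝓘(ℝ, E) x) (lieEndo X N x) * formAt μ x (fun l => e l x) := by
    simp only [hterm, Finset.sum_add_distrib]
    congr 1
    · rw [Finset.sum_comm, Finset.mul_sum]
      exact Finset.sum_congr rfl fun i _ => sum_update_endo_eq_trace_mul (N x) (formAt μ x) (v i)
    · simp only [Finset.sum_ite_eq', Finset.mem_univ, if_true]
      exact sum_update_endo_eq_trace_mul (lieEndo X N x) (formAt μ x) _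
  have hsum' : ∑ j, lieDeriv X μ x (fun i => Z j i x) =
      LinearMap.trace ℝ (TangentSpace 𝓘(ℝ, E) x) (N x) * lieDeriv X μ x (fun i => e i x) := by
    simp only [hZ]
    exact sum_update_endo_eq_trace_mul (N x) (lieDeriv X μ x) _
  rw [hsum, hsum'] at hL
  simp only [add_apply, smul_apply, ContinuousLinearMap.smulRight_apply, smul_eq_mul,
    mvfderiv_formAt_apply, h1] at hL
  change LinearMap.trace ℝ (TangentSpace 𝓘(ℝ, E) x) (N x) * (lieDeriv X μ x (fun i => e i x) +
    ∑ i, formAt μ x (v i)) + derivAlong X (traceFun N) x * 1 = _ at hL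
  linarith

end Trace

/-! ### Closed one-forms of the Nijenhuis algebroid -/

section Closed
variable {E : Type*} [NormedAddCommGroup E] [NormedSpace ℝ E] [FiniteDimensional ℝ E]
  {M : Type*} [TopologicalSpace M] [ChartedSpace E M] [IsManifold 𝓘(ℝ, E) ∞ M]

local notation "TM" => (TangentSpace 𝓘(ℝ, E) : M → Type _)

lemma derivAlong_add (X Y : VF E M) (f : Fun E M) (x : M) :
    derivAlong (X + Y) f x = derivAlong X f x + derivAlong Y f x :=
  map_add (mvfderiv 𝓘(ℝ, E) f x) (X x) (Y x)

lemma derivAlong_sub (X Y : VF E M) (f : Fun E M) (x : M) :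
    derivAlong (X - Y) f x = derivAlong X f x - derivAlong Y f x :=
  map_sub (mvfderiv 𝓘(ℝ, E) f x) (X x) (Y x)

/-- The square `N²` of a `(1,1)`-tensor. -/
def endoSq (N : EndoField E M) : EndoField E M :=
  ⟨fun x => (N x).comp (N x), by
    intro x₀
    rw [contMDiffAt_hom_bundle]
    refine ⟨contMDiffAt_id, ?_⟩
    have h := ((contMDiffAt_hom_bundle _).1 (N.contMDiff x₀)).2
    refine (h.clm_comp h).congr_of_eventuallyEq ?_
    filter_upwards [(trivializationAt E TM x₀).open_baseSet.mem_nhds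
      (FiberBundle.mem_baseSet_trivializationAt' x₀)] with y hy
    ext v
    have hs := (trivializationAt E TM x₀).symmL_continuousLinearMapAt (R := ℝ) hy
    simp only [ContinuousLinearMap.inCoordinates, ContinuousLinearMap.comp_apply, hs]⟩

/-- The trace of `L_X (N²) = (L_X N) N + N (L_X N)`. -/
lemma derivAlong_traceFun_endoSq [T2Space M] (X : VF E M) (N : EndoField E M) (x : M) :
    derivAlong X (traceFun (endoSq N)) x =
      2 * LinearMap.trace ℝ (TangentSpace 𝓘(ℝ, E) x) ((N x).comp (lieEndo X N x)) := by
  rw [← trace_lieEndo]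
  have h : ((lieEndo X (endoSq N) x :
        TangentSpace 𝓘(ℝ, E) x →L[ℝ] TangentSpace 𝓘(ℝ, E) x) : _ →ₗ[ℝ] _) =
      (lieEndo X N x : TangentSpace 𝓘(ℝ, E) x →ₗ[ℝ] TangentSpace 𝓘(ℝ, E) x) ∘ₗ
          (N x : TangentSpace 𝓘(ℝ, E) x →ₗ[ℝ] TangentSpace 𝓘(ℝ, E) x) +
        (N x : TangentSpace 𝓘(ℝ, E) x →ₗ[ℝ] TangentSpace 𝓘(ℝ, E) x) ∘ₗ
          (lieEndo X N x : TangentSpace 𝓘(ℝ, E) x →ₗ[ℝ] TangentSpace 𝓘(ℝ, E) x) := by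
    ext v
    obtain ⟨Z, rfl⟩ := exists_vf_apply_eq v
    change lieEndo X (endoSq N) x (Z x) =
      lieEndo X N x (applyEndo N Z x) + N x (lieEndo X N x (Z x))
    rw [lieEndo_apply, lieEndo_apply, lieEndo_apply, map_sub]
    change vfBracket X (applyEndo N (applyEndo N Z)) x - N x (N x _) = _
    abel
  have hc : LinearMap.trace ℝ (TangentSpace 𝓘(ℝ, E) x)
      ((lieEndo X N x : TangentSpace 𝓘(ℝ, E) x →ₗ[ℝ] TangentSpace 𝓘(ℝ, E) x) ∘ₗ
        (N x : TangentSpace 𝓘(ℝ, E) x →ₗ[ℝ] TangentSpace 𝓘(ℝ, E) x)) = _ :=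
    LinearMap.trace_mul_comm ℝ _ _
  rw [h, map_add, hc, two_mul]
  rfl

/-- Vanishing of the torsion says `L_{NX} N = N L_X N`; taking traces,
`(NX)(Tr N) = ½ X (Tr N²)`. -/
lemma derivAlong_applyEndo_traceFun [T2Space M] {N : EndoField E M} (hN : IsNijenhuis N)
    (X : VF E M) (x : M) :
    2 * derivAlong (applyEndo N X) (traceFun N) x = derivAlong X (traceFun (endoSq N)) x := by
  rw [derivAlong_traceFun_endoSq, ← trace_lieEndo]
  congr 3
  ext v
  obtain ⟨Z, rfl⟩ := exists_vf_apply_eq v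
  have h := congrArg (fun W : VF E M => W x) (sub_eq_zero.1 (hN X Z))
  change vfBracket (applyEndo N X) (applyEndo N Z) x =
    N x (vfBracket (applyEndo N X) Z x + vfBracket X (applyEndo N Z) x -
      N x (vfBracket X Z x)) at h
  change _ = N x (lieEndo X N x (Z x))
  rw [lieEndo_apply, lieEndo_apply, h, map_sub, map_sub, map_add]
  abel

lemma nijenhuis_dForm_differential (N : EndoField E M) (hN : IsNijenhuis N) (f : Fun E M)
    (X Y : VF E M) (x : M) :
    (nijenhuisAlgebroid N hN).dForm (differential f) X Y x =
      derivAlong (applyEndo N X) (derivAlong Y f) x -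
        derivAlong (applyEndo N Y) (derivAlong X f) x -
          derivAlong (deformedBracket N X Y) f x := rfl

/-- `d Tr N` is closed: with `f = Tr N` and `g = ½ Tr N²`, so that `(NX) f = X g`, the value of
`d_N (df)` on `X`, `Y` is `[X, Y] g - X (Y g) + Y (X g)`. -/
lemma differential_traceFun_mem_cocycles [T2Space M] (N : EndoField E M) (hN : IsNijenhuis N) :
    differential (traceFun N) ∈ (nijenhuisAlgebroid N hN).cocycles := by
  intro X Y x
  rw [nijenhuis_dForm_differential]
  have hg (Z : VF E M) : derivAlong Z (traceFun (endoSq N)) =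
      (2 : ℝ) • derivAlong (applyEndo N Z) (traceFun N) := by
    ext y
    exact (derivAlong_applyEndo_traceFun hN Z y).symm
  have hs (Z : VF E M) (f : Fun E M) : derivAlong Z ((2 : ℝ) • f) x = 2 * derivAlong Z f x := by
    have h : mvfderiv 𝓘(ℝ, E) ((fun _ : M => (2 : ℝ)) • (f : M → ℝ)) x (Z x) =
        2 * mvfderiv 𝓘(ℝ, E) f x (Z x) := by
      rw [mvfderiv_smul mdifferentiableAt_const (f.contMDiff.mdifferentiable (by simp) x),
        mvfderiv_const]
      simp
    exact h
  have h1 := derivAlong_vfBracket (applyEndo N X) Y (traceFun N) x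
  have h2 := derivAlong_vfBracket X (applyEndo N Y) (traceFun N) x
  have h3 := derivAlong_vfBracket X Y (traceFun (endoSq N)) x
  have h4 := derivAlong_applyEndo_traceFun hN (vfBracket X Y) x
  rw [hg X, hg Y, hs, hs] at h3
  rw [deformedBracket, derivAlong_sub, derivAlong_add]
  linarith

end Closed

/-- `d_A ∘ d_A = 0` on functions, as the anchor preserves brackets. -/
lemma coboundaries_le_cocycles
    {E : Type*} [NormedAddCommGroup E] [NormedSpace ℝ E] [FiniteDimensional ℝ E]
    {M : Type*} [TopologicalSpace M] [T2Space M] [ChartedSpace E M] [IsManifold 𝓘(ℝ, E) ∞ M]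
    {F : Type*} [NormedAddCommGroup F] [NormedSpace ℝ F] [FiniteDimensional ℝ F]
    {V : M → Type*}
    [TopologicalSpace (TotalSpace F V)] [∀ x, AddCommGroup (V x)] [∀ x, Module ℝ (V x)]
    [∀ x, TopologicalSpace (V x)] [FiberBundle F V] [VectorBundle ℝ F V]
    [ContMDiffVectorBundle ∞ F V 𝓘(ℝ, E)] (A : LieAlgebroid E F V) :
    A.coboundaries ≤ A.cocycles := by
  rintro _ ⟨f, rfl⟩ X Y x
  have h := derivAlong_vfBracket (A.anchorField X) (A.anchorField Y) f x
  have hb : vfBracket (A.anchorField X) (A.anchorField Y) x =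
      A.anchor x (A.bracket X Y x) := (A.anchor_bracket X Y x).symm
  rw [derivAlong_apply, hb] at h
  change derivAlong (A.anchorField X) (derivAlong (A.anchorField Y) f) x -
    derivAlong (A.anchorField Y) (derivAlong (A.anchorField X) f) x -
      mvfderiv 𝓘(ℝ, E) f x (A.anchor x (A.bracket X Y x)) = 0
  rw [h, sub_self]

/-! ### Modular one-forms -/

section Modular
variable {E : Type*} [NormedAddCommGroup E] [NormedSpace ℝ E] [FiniteDimensional ℝ E]
  {M : Type*} [TopologicalSpace M] [ChartedSpace E M] [IsManifold 𝓘(ℝ, E) ∞ M]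

local notation "TM" => (TangentSpace 𝓘(ℝ, E) : M → Type _)

/-- The function `h` with `s = h s₀`, where `s₀` is the canonical section of `Λⁿ TM ⊗ Λⁿ T*M`. -/
def density (s : TopSection E E TM) : Fun E M :=
  ⟨fun x => contraction (s.toFun x), by
    intro x
    obtain ⟨e, μ, h⟩ := s.smooth x
    refine (contMDiffAt_formAt_apply μ (Z := fun i => e i)
      fun i => (e i).contMDiff x).congr_of_eventuallyEq ?_
    filter_upwards [h] with y hy
    rw [hy, wedge, contraction_tmul]⟩

lemma density_ne_zero (s : TopSection E E TM) (x : M) : density s x ≠ 0 := fun h =>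
  s.ne_zero x (contraction_injective (tangentBasis x) (h.trans (map_zero _).symm))

/-- The function `log |h|` for the density `h` of a nowhere vanishing section. -/
def logDensity (s : TopSection E E TM) : Fun E M :=
  ⟨fun x => Real.log (density s x), fun x =>
    ((Real.contDiffAt_log.2 (density_ne_zero s x)).contMDiffAt).comp x
      (density s).contMDiff.contMDiffAt⟩

lemma derivAlong_logDensity (s : TopSection E E TM) (X : VF E M) (x : M) :
    derivAlong X (logDensity s) x * density s x = derivAlong X (density s) x := by
  have h := density_ne_zero s x
  have hc := (Real.hasDerivAt_log h).hasFDerivAt.hasMFDerivAt.comp x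
    ((density s).contMDiff.mdifferentiable (by simp) x).hasMFDerivAt
  have h1 : derivAlong X (logDensity s) x = derivAlong X (density s) x * (density s x)⁻¹ :=
    congrArg (fun T : E →L[ℝ] ℝ => T (X x)) hc.mfderiv
  rw [h1, inv_mul_cancel_right₀ h]

/-- The defining equation of the modular form, contracted: the brackets `[NX, eⱼ]` cancel against
those in the Lie derivative of `μ`, and what remains is `(NX) h` and the trace of `L_X N`. -/
lemma contraction_modular [T2Space M] (N : EndoField E M) (hN : IsNijenhuis N)
    (s : TopSection E E TM) (X : VF E M) (x : M) (e : Fin (finrank ℝ E) → VF E M)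
    (μ : Form E M (finrank ℝ E)) (h : ∀ᶠ y in 𝓝 x, s.toFun y = wedge e y ⊗ₜ[ℝ] formAt μ y) :
    contraction ((nijenhuisAlgebroid N hN).bracketWedge X e x ⊗ₜ[ℝ] formAt μ x +
      wedge e x ⊗ₜ[ℝ] lieDeriv ((nijenhuisAlgebroid N hN).anchorField X) μ x) =
      derivAlong (applyEndo N X) (density s) x +
        derivAlong X (traceFun N) x * density s x := by
  have hh : density s =ᶠ[𝓝 x] fun y => formAt μ y (fun i => e i y) := by
    filter_upwards [h] with y hy
    change contraction (s.toFun y) = _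
    rw [hy, wedge, contraction_tmul]
  have hd : derivAlong (applyEndo N X) (density s) x =
      mvfderiv 𝓘(ℝ, E) (fun y => formAt μ y (fun i => e i y)) x (applyEndo N X x) :=
    congrArg (fun T : E →L[ℝ] ℝ => T (applyEndo N X x))
      (hh.mfderiv_eq (I := 𝓘(ℝ, E)) (I' := 𝓘(ℝ, ℝ)))
  rw [hd, mvfderiv_formAt_apply, hh.eq_of_nhds, ← trace_lieEndo,
    ← sum_update_endo_eq_trace_mul (lieEndo X N x), LieAlgebroid.bracketWedge, map_add,
    TensorProduct.sum_tmul, map_sum, wedge, contraction_tmul]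
  simp only [contraction_tmul]
  have hb (j) : (nijenhuisAlgebroid N hN).bracket X (e j) x =
      vfBracket (applyEndo N X) (e j) x + lieEndo X N x (e j x) := by
    rw [lieEndo_apply]
    exact add_sub_assoc _ _ _
  simp only [hb, AlternatingMap.map_update_add, Finset.sum_add_distrib]
  change _ + lieDeriv (applyEndo N X) μ x _ = _
  ring

/-- The modular form of the section with density `h` is `d Tr N + d_N log |h|`. -/
def modularForm (N : EndoField E M) (hN : IsNijenhuis N) (s : TopSection E E TM) :
    DualSec E E TM :=
  differential (traceFun N) + (nijenhuisAlgebroid N hN).dFun (logDensity s)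

lemma isModularForm_iff [T2Space M] (N : EndoField E M) (hN : IsNijenhuis N)
    (s : TopSection E E TM) (η : DualSec E E TM) :
    (nijenhuisAlgebroid N hN).IsModularForm s η ↔ η = modularForm N hN s := by
  have key (X : VF E M) (x : M) : derivAlong (applyEndo N X) (density s) x +
        derivAlong X (traceFun N) x * density s x =
      pairing (modularForm N hN s) X x * density s x := by
    rw [← derivAlong_logDensity]
    change _ = (derivAlong X (traceFun N) x +
      derivAlong (applyEndo N X) (logDensity s) x) * density s x
    ring
  constructor
  · intro h
    ext x v
    obtain ⟨X, rfl⟩ := exists_vf_apply_eq v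
    obtain ⟨e, μ, hs⟩ := s.smooth x
    have h1 := congrArg contraction (h X x e μ hs)
    rw [map_smul, contraction_modular N hN s X x e μ hs, key] at h1
    exact mul_right_cancel₀ (density_ne_zero s x) h1
  · rintro rfl X x e μ hs
    refine contraction_injective (tangentBasis x) ?_
    rw [map_smul, contraction_modular N hN s X x e μ hs, key]
    rfl

end Modular

end NijenhuisModular
end

theorem mainTheorem5 {E : Type*} [NormedAddCommGroup E] [NormedSpace ℝ E] [FiniteDimensional ℝ E]
    {M : Type*} [TopologicalSpace M] [T2Space M] [ChartedSpace E M] [IsManifold 𝓘(ℝ, E) ∞ M]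
    (N : NijenhuisModular.EndoField E M) (hN : NijenhuisModular.IsNijenhuis N) :
    ∃ h : NijenhuisModular.differential (NijenhuisModular.traceFun N) ∈
        (NijenhuisModular.nijenhuisAlgebroid N hN).cocycles,
      (NijenhuisModular.nijenhuisAlgebroid N hN).IsModularClass
        ((NijenhuisModular.nijenhuisAlgebroid N hN).cohomologyClass
          (NijenhuisModular.differential (NijenhuisModular.traceFun N)) h) := by
  open NijenhuisModular in
  have hT := differential_traceFun_mem_cocycles N hN
  refine ⟨hT, ⟨canonicalSection⟩, fun s => ⟨modularForm N hN s, ?_, isModularForm_iff N hN s, ?_⟩⟩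
  · exact Submodule.add_mem _ hT
      (coboundaries_le_cocycles _ (LinearMap.mem_range_self _ _))
  · refine (Submodule.Quotient.eq _).2 ?_
    change _ ∈ LieAlgebroid.coboundaries _
    refine ⟨logDensity s, ?_⟩
    exact (add_sub_cancel_left _ _).symm
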